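/- Let $K$ be a field of characteristic different from $2$, let $q\in K\setminus\{0\}$ with $q^2\neq 1$, and let $n\geq 2$. For $\lambda\in K\setminus\{0\}$ put $I_\lambda=\{\lambda^{\epsilon}q^{2t}\mid \epsilon\in\{-1,1\},\ t\in\mathbb Z\}$. Let $\boldsymbol\lambda=(\lambda_1,\dots,\lambda_l)$ be a tuple of elements of $K\setminus\{0\}$ with $I_{\lambda_a}\cap I_{\lambda_b}=\emptyset$ for $a\neq b$, and let $S=S_{\boldsymbol\lambda}=I_{\lambda_1}\cup\dots\cup I_{\lambda_l}$. For $i,j\in S$ write $i\nleftrightarrow j$ if $i\neq j$ and $j\notin\{q^2i,q^{-2}i\}$; $i\to j$ if $j=q^2i\neq q^{-2}i$; $i\leftarrow j$ if $j=q^{-2}i\neq q^2i$; $i\leftrightarrow j$ if $j=q^2i=q^{-2}i$. The Weyl group $W(B_n)=\langle r_0,\dots,r_{n-1}\rangle$ acts on $S^n$ by $r_0(i_1,\dots,i_n)=(i_1^{-1},i_2,\dots,i_n)$ and by letting $r_k$ exchange $i_k$ and $i_{k+1}$ for $1\le k\le n-1$. Put also $s_0(i_1,\dots,i_n)=(i_2^{-1},i_1^{-1},i_3,\dots,i_n)$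 and $s_k=r_k$ for $k\geq1$. Let $\beta\subset S^n$ be a $W(B_n)$-orbit (it is finite, and stable under all $s_k$). Consider generators $\psi_a$ ($0\le a\le n-1$), $y_j$ ($1\le j\le n$), $e(\mathbf i)$ ($\mathbf i\in\beta$), and the following relations, for $\mathbf i,\mathbf j\in\beta$, where $b,b'\in\{1,\dots,n-1\}$ and $\pi_b$ is the transposition $(b\ b+1)$: (1) $\sum_{\mathbf i\in\beta}e(\mathbf i)=1$, $e(\mathbf i)e(\mathbf j)=\delta_{\mathbf i,\mathbf j}e(\mathbf i)$, $y_jy_k=y_ky_j$, $y_je(\mathbf i)=e(\mathbf i)y_j$; (2) $\psi_be(\mathbf i)=e(r_b(\mathbf i))\psi_b$; $\psi_b\psi_{b'}=\psi_{b'}\psi_b$ if $|b-b'|>1$; (3) $(\psi_by_j-y_{\pi_b(j)}\psi_b)e(\mathbf i)$ equals $-e(\mathbf i)$ if $j=b$ and $i_b=i_{b+1}$, equals $e(\mathbf i)$ if $j=b+1$ and $i_b=i_{b+1}$, and equals $0$ otherwise; (4) $\psi_b^2e(\mathbf i)$ equals $0$ if $i_b=i_{b+1}$; $e(\mathbf i)$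 if $i_b\nleftrightarrow i_{b+1}$; $(y_{b+1}-y_b)e(\mathbf i)$ if $i_b\to i_{b+1}$; $(y_b-y_{b+1})e(\mathbf i)$ if $i_b\leftarrow i_{b+1}$; $(y_{b+1}-y_b)(y_b-y_{b+1})e(\mathbf i)$ if $i_b\leftrightarrow i_{b+1}$; (5) for $b\le n-2$, $(\psi_b\psi_{b+1}\psi_b-\psi_{b+1}\psi_b\psi_{b+1})e(\mathbf i)$ equals $e(\mathbf i)$ if $i_b=i_{b+2}\to i_{b+1}$; $-e(\mathbf i)$ if $i_b=i_{b+2}\leftarrow i_{b+1}$; $(y_{b+2}-2y_{b+1}+y_b)e(\mathbf i)$ if $i_b=i_{b+2}\leftrightarrow i_{b+1}$; $0$ otherwise. Let $V^\beta_{\boldsymbol\lambda}$ be the unital $K$-algebra with these generators and with relations (1)--(5) together with $\psi_0e(\mathbf i)=e(r_0(\mathbf i))\psi_0$; $\psi_0\psi_b=\psi_b\psi_0$ for $b>1$; $\psi_0y_1+y_1\psi_0=0$; $\psi_0y_j=y_j\psi_0$ for $j>1$; $\psi_0^2=1$; $(\psi_0\psi_1)^2=(\psi_1\psi_0)^2$.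 Let $W^\beta_{\boldsymbol\lambda}$ be the unital $K$-algebra with generators $\Psi_a,y_j,e(\mathbf i)$ (same index sets) and with relations (1)--(5), where $\psi_b$ is replaced by $\Psi_b$, together with $\Psi_0e(\mathbf i)=e(s_0(\mathbf i))\Psi_0$; $\Psi_0\Psi_b=\Psi_b\Psi_0$ if $b=1$ or $b>2$; and - $\Psi_0y_je(\mathbf i)$ equals $(-y_{\pi_1(j)}\Psi_0+1)e(\mathbf i)$ if $j\in\{1,2\}$ and $i_1^{-1}=i_2$; $-y_{\pi_1(j)}\Psi_0e(\mathbf i)$ if $j\in\{1,2\}$ and $i_1^{-1}\ne i_2$; $y_j\Psi_0e(\mathbf i)$ if $j>2$; - $\Psi_0^2e(\mathbf i)$ equals $0$ if $i_1^{-1}=i_2$; $e(\mathbf i)$ if $i_1^{-1}\nleftrightarrow i_2$; $(y_1+y_2)e(\mathbf i)$ if $i_1^{-1}\to i_2$; $-(y_1+y_2)e(\mathbf i)$ if $i_1^{-1}\leftarrow i_2$; $-(y_1+y_2)^2e(\mathbf i)$ if $i_1^{-1}\leftrightarrow i_2$; - if $n\geq3$, $(\Psi_0\Psi_2\Psi_0-\Psi_2\Psi_0\Psi_2)e(\mathbf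 i)$ equals $e(\mathbf i)$ if $i_1^{-1}=i_3\to i_2$; $-e(\mathbf i)$ if $i_1^{-1}=i_3\leftarrow i_2$; $(y_3-2y_2-y_1)e(\mathbf i)$ if $i_1^{-1}=i_3\leftrightarrow i_2$; $0$ otherwise. Let $m:S\to\mathbb Z_{\ge0}$ be a map with finite support, and let $V^\beta_{\boldsymbol\lambda,m}$ and $W^\beta_{\boldsymbol\lambda,m}$ be the quotients of $V^\beta_{\boldsymbol\lambda}$ and $W^\beta_{\boldsymbol\lambda}$ by the relations $y_1^{m(i_1)}e(\mathbf i)=0$ for all $\mathbf i\in\beta$. Let $\tilde\rho$ be the involutive automorphism of $V^\beta_{\boldsymbol\lambda,m}$ induced by the automorphism $\rho$ of $V^\beta_{\boldsymbol\lambda}$ with $\psi_0\mapsto-\psi_0$ that fixes all other generators $\psi_b$ ($b\ge1$), $y_j$, $e(\mathbf i)$. **Proposition.** Assume that $m(i^{-1})=m(i)$ for all $i\in S$. Then the $K$-algebra $W^\beta_{\boldsymbol\lambda,m}$ is isomorphic to the fixed-point subalgebra $\bigl(V^\beta_{\boldsymbol\lambda,m}\bigr)^{\tilde\rho}=\{x\in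 V^\beta_{\boldsymbol\lambda,m}\mid\tilde\rho(x)=x\}$. -/

import Mathlib

namespace QuiverHeckeBD

/-! ## Vertices and arrows -/

section Vertices

variable {K : Type*} [Field K]

/-- `I_λ = {λ^ε q^{2l} | ε ∈ {-1, 1}, l ∈ ℤ}`, as a subset of `K \ {0} = Kˣ`. -/
def I (q x : Kˣ) : Set Kˣ :=
  {i | ∃ l : ℤ, i = x * q ^ (2 * l) ∨ i = x⁻¹ * q ^ (2 * l)}

/-- `S_λ = I_{λ_1} ∪ … ∪ I_{λ_l}` for a tuple `λ = (λ_1, …, λ_l)`. -/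
def S (q : Kˣ) {l : ℕ} (lam : Fin l → Kˣ) : Set Kˣ :=
  ⋃ a, I q (lam a)

theorem inv_mem_S {q : Kˣ} {l : ℕ} {lam : Fin l → Kˣ} {i : Kˣ} (hi : i ∈ S q lam) :
    i⁻¹ ∈ S q lam := by
  obtain ⟨a, t, ht⟩ := Set.mem_iUnion.mp hi
  refine Set.mem_iUnion.mpr ⟨a, -t, ?_⟩
  rcases ht with rfl | rfl
  · right
    rw [mul_inv, mul_neg, zpow_neg]
  · left
    rw [mul_inv, mul_neg, zpow_neg, inv_inv]

/-- The vertices of the quiver: elements of `S_λ`. -/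
abbrev Vertex (q : Kˣ) {l : ℕ} (lam : Fin l → Kˣ) : Type _ := S q lam

/-- The involution `i ↦ i⁻¹` of `S_λ`. -/
instance instInvVertex (q : Kˣ) {l : ℕ} (lam : Fin l → Kˣ) : InvolutiveInv (Vertex q lam) where
  inv i := ⟨(i : Kˣ)⁻¹, inv_mem_S i.2⟩
  inv_inv i := Subtype.ext (inv_inv (i : Kˣ))

variable {q : Kˣ} {l : ℕ} {lam : Fin l → Kˣ}

/-- `i ↮ j`. -/
def NoArrow (i j : Vertex q lam) : Prop :=
  i ≠ j ∧ (j : Kˣ) ≠ q ^ (2 : ℤ) * i ∧ (j : Kˣ) ≠ q ^ (-2 : ℤ) * i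

/-- `i → j`. -/
def ArrowTo (i j : Vertex q lam) : Prop :=
  (j : Kˣ) = q ^ (2 : ℤ) * i ∧ q ^ (2 : ℤ) * (i : Kˣ) ≠ q ^ (-2 : ℤ) * i

/-- `i ← j`. -/
def ArrowFrom (i j : Vertex q lam) : Prop :=
  (j : Kˣ) = q ^ (-2 : ℤ) * i ∧ q ^ (-2 : ℤ) * (i : Kˣ) ≠ q ^ (2 : ℤ) * i

/-- `i ↔ j`. -/
def ArrowBoth (i j : Vertex q lam) : Prop :=
  (j : Kˣ) = q ^ (2 : ℤ) * i ∧ q ^ (2 : ℤ) * (i : Kˣ) = q ^ (-2 : ℤ) * i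

end Vertices

/-! ## Weyl group actions on tuples

Positions `1, …, n` of a tuple are the elements `0, …, n - 1` of `Fin n`, so that `i_1` is `i 0`.
The generators `r_a`, `s_a`, `ψ_a`, `Ψ_a` with `a ∈ {0, …, n - 1}` are indexed by `a : Fin n`.
Thus for `b : Fin n`, `b ≠ 0`, the positions that are called `b` and `b + 1` in the usual
1-based numbering are `pr b` and `b`. -/

section Weyl

variable {n : ℕ}

/-- The predecessor in `Fin n` (used for nonzero arguments). -/
def pr (b : Fin n) : Fin n := ⟨b.val - 1, by omega⟩

variable [NeZero n] {V : Type*} [InvolutiveInv V]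

/-- `r_0 · (i_1, …, i_n) = (i_1⁻¹, i_2, …, i_n)`, and `r_b` exchanges the entries `i_b`, `i_{b+1}`
if `b ≠ 0`. -/
def rFun (a : Fin n) (i : Fin n → V) : Fin n → V :=
  if a = 0 then fun j => if j = 0 then (i 0)⁻¹ else i j
  else fun j => i (Equiv.swap (pr a) a j)

theorem rFun_involutive (a : Fin n) : Function.Involutive (rFun a : (Fin n → V) → Fin n → V) := by
  intro i
  funext j
  unfold rFun
  by_cases h : a = 0
  · by_cases hj : j = 0 <;> simp [h, hj]
  · simp [h]

/-- `r_a` as a permutation of the set of `n`-tuples. -/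
def r (a : Fin n) : Equiv.Perm (Fin n → V) := (rFun_involutive a).toPerm

/-- The group of permutations of `Vⁿ` through which the Weyl group `W(B_n)` acts, i.e. the group
generated by `r_0, …, r_{n-1}`. -/
def weylB (n : ℕ) [NeZero n] (V : Type*) [InvolutiveInv V] : Subgroup (Equiv.Perm (Fin n → V)) :=
  Subgroup.closure (Set.range r)

/-- The `W(B_n)`-orbit of a tuple. -/
def orbitB (i : Fin n → V) : Set (Fin n → V) := {j | ∃ w ∈ weylB n V, w i = j}

/-- `s_0 · (i_1, …, i_n) = (i_2⁻¹, i_1⁻¹, i_3, …, i_n)`, and `s_b` exchanges the entries `i_b`,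
`i_{b+1}` if `b ≠ 0` (for `n ≥ 2`). -/
def s (a : Fin n) (i : Fin n → V) : Fin n → V :=
  if a = 0 then fun j => if j.val = 0 then (i 1)⁻¹ else if j.val = 1 then (i 0)⁻¹ else i j
  else fun j => i (Equiv.swap (pr a) a j)

end Weyl

/-! ## The algebras `V` and `W` -/

section Algebras

variable {K : Type*} [Field K] {q : Kˣ} {l : ℕ} {lam : Fin l → Kˣ} {n : ℕ}

/-- The symbols `ψ_a` (or `Ψ_a`), `y_j`, `e(i)`; here `y j` stands for `y_{j+1}` in the usual
1-based numbering. -/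
inductive Gen (β : Finset (Fin n → Vertex q lam)) : Type _
  | psi (a : Fin n)
  | y (j : Fin n)
  | e (i : β)

/-- The free algebra on these symbols. -/
abbrev Free (β : Finset (Fin n → Vertex q lam)) : Type _ := FreeAlgebra K (Gen β)

namespace Free

variable {β : Finset (Fin n → Vertex q lam)}

/-- The generator `ψ_a` of the free algebra. -/
noncomputable def psi (a : Fin n) : Free β := FreeAlgebra.ι K (Gen.psi a)

/-- The generator `y_j` of the free algebra. -/
noncomputable def y (j : Fin n) : Free β := FreeAlgebra.ι K (Gen.y j)

/-- The generator `e(i)` of the free algebra. -/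
noncomputable def e (i : β) : Free β := FreeAlgebra.ι K (Gen.e i)

end Free

open Free

variable [NeZero n]

/-- The defining relations of `V_λ^β`, for a finite `W(B_n)`-stable set `β` of tuples. In
the relation `psi_e`, the tuple `j` is `r_a(i)`. -/
inductive VRel (β : Finset (Fin n → Vertex q lam)) : Free β → Free β → Prop
  | sum_e : VRel β (∑ i : β, e i) 1
  | e_mul_self (i : β) : VRel β (e i * e i) (e i)
  | e_mul_ne (i j : β) : i ≠ j → VRel β (e i * e j) 0
  | y_comm (j k : Fin n) : VRel β (y j * y k) (y k * y j)
  | y_e (j : Fin n) (i : β) : VRel β (y j * e i) (e i * y j)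
  | psi_e (a : Fin n) (i j : β) : j.1 = r a i.1 → VRel β (psi a * e i) (e j * psi a)
  | psi_y_left (b : Fin n) (i : β) : b ≠ 0 → i.1 (pr b) = i.1 b →
      VRel β ((psi b * y (pr b) - y b * psi b) * e i) (-e i)
  | psi_y_right (b : Fin n) (i : β) : b ≠ 0 → i.1 (pr b) = i.1 b →
      VRel β ((psi b * y b - y (pr b) * psi b) * e i) (e i)
  | psi_y_else (b j : Fin n) (i : β) : b ≠ 0 → ¬ ((j = pr b ∨ j = b) ∧ i.1 (pr b) = i.1 b) →
      VRel β ((psi b * y j - y (Equiv.swap (pr b) b j) * psi b) * e i) 0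
  | psi_comm (a b : Fin n) : b ≠ 0 → 1 < |(a.val : ℤ) - b.val| →
      VRel β (psi a * psi b) (psi b * psi a)
  | psi_sq_eq (b : Fin n) (i : β) : b ≠ 0 → i.1 (pr b) = i.1 b →
      VRel β (psi b ^ 2 * e i) 0
  | psi_sq_none (b : Fin n) (i : β) : b ≠ 0 → NoArrow (i.1 (pr b)) (i.1 b) →
      VRel β (psi b ^ 2 * e i) (e i)
  | psi_sq_to (b : Fin n) (i : β) : b ≠ 0 → ArrowTo (i.1 (pr b)) (i.1 b) →
      VRel β (psi b ^ 2 * e i) ((y b - y (pr b)) * e i)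
  | psi_sq_from (b : Fin n) (i : β) : b ≠ 0 → ArrowFrom (i.1 (pr b)) (i.1 b) →
      VRel β (psi b ^ 2 * e i) ((y (pr b) - y b) * e i)
  | psi_sq_both (b : Fin n) (i : β) : b ≠ 0 → ArrowBoth (i.1 (pr b)) (i.1 b) →
      VRel β (psi b ^ 2 * e i) ((y b - y (pr b)) * (y (pr b) - y b) * e i)
  | braid_to (b c : Fin n) (i : β) : b ≠ 0 → c.val = b.val + 1 →
      i.1 (pr b) = i.1 c → ArrowTo (i.1 c) (i.1 b) →
      VRel β ((psi b * psi c * psi b - psi c * psi b * psi c) * e i) (e i)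
  | braid_from (b c : Fin n) (i : β) : b ≠ 0 → c.val = b.val + 1 →
      i.1 (pr b) = i.1 c → ArrowFrom (i.1 c) (i.1 b) →
      VRel β ((psi b * psi c * psi b - psi c * psi b * psi c) * e i) (-e i)
  | braid_both (b c : Fin n) (i : β) : b ≠ 0 → c.val = b.val + 1 →
      i.1 (pr b) = i.1 c → ArrowBoth (i.1 c) (i.1 b) →
      VRel β ((psi b * psi c * psi b - psi c * psi b * psi c) * e i)
        ((y c - 2 * y b + y (pr b)) * e i)
  | braid_else (b c : Fin n) (i : β) : b ≠ 0 → c.val = b.val + 1 →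
      ¬ (i.1 (pr b) = i.1 c ∧
        (ArrowTo (i.1 c) (i.1 b) ∨ ArrowFrom (i.1 c) (i.1 b) ∨ ArrowBoth (i.1 c) (i.1 b))) →
      VRel β ((psi b * psi c * psi b - psi c * psi b * psi c) * e i) 0
  | psi0_y1 : VRel β (psi 0 * y 0 + y 0 * psi 0) 0
  | psi0_y (j : Fin n) : j ≠ 0 → VRel β (psi 0 * y j) (y j * psi 0)
  | psi0_sq : VRel β (psi 0 ^ 2) 1
  | braid0 (b : Fin n) : b.val = 1 →
      VRel β ((psi 0 * psi b) ^ 2 - (psi b * psi 0) ^ 2) 0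

/-- The defining relations of `W_λ^δ`, for `n ≥ 2` and a finite `W(D_n)`-stable set `δ` of
tuples. In the relation `psi_e`, the tuple `j` is `s_a(i)`; in the relations with `Ψ_0`, the
positions `1`, `2`, `3` of a tuple are `0`, `t` (where `t` has value 1) and `u` (where `u` has
value 2), and the generator `Ψ_2` is `psi u`. -/
inductive WRel (δ : Finset (Fin n → Vertex q lam)) : Free δ → Free δ → Prop
  | sum_e : WRel δ (∑ i : δ, e i) 1
  | e_mul_self (i : δ) : WRel δ (e i * e i) (e i)
  | e_mul_ne (i j : δ) : i ≠ j → WRel δ (e i * e j) 0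
  | y_comm (j k : Fin n) : WRel δ (y j * y k) (y k * y j)
  | y_e (j : Fin n) (i : δ) : WRel δ (y j * e i) (e i * y j)
  | psi_e (a : Fin n) (i j : δ) : j.1 = s a i.1 → WRel δ (psi a * e i) (e j * psi a)
  | psi_y_left (b : Fin n) (i : δ) : b ≠ 0 → i.1 (pr b) = i.1 b →
      WRel δ ((psi b * y (pr b) - y b * psi b) * e i) (-e i)
  | psi_y_right (b : Fin n) (i : δ) : b ≠ 0 → i.1 (pr b) = i.1 b →
      WRel δ ((psi b * y b - y (pr b) * psi b) * e i) (e i)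
  | psi_y_else (b j : Fin n) (i : δ) : b ≠ 0 → ¬ ((j = pr b ∨ j = b) ∧ i.1 (pr b) = i.1 b) →
      WRel δ ((psi b * y j - y (Equiv.swap (pr b) b j) * psi b) * e i) 0
  | psi_comm (b b' : Fin n) : b ≠ 0 → b' ≠ 0 → 1 < |(b'.val : ℤ) - b.val| →
      WRel δ (psi b * psi b') (psi b' * psi b)
  | psi_sq_eq (b : Fin n) (i : δ) : b ≠ 0 → i.1 (pr b) = i.1 b →
      WRel δ (psi b ^ 2 * e i) 0
  | psi_sq_none (b : Fin n) (i : δ) : b ≠ 0 → NoArrow (i.1 (pr b)) (i.1 b) →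
      WRel δ (psi b ^ 2 * e i) (e i)
  | psi_sq_to (b : Fin n) (i : δ) : b ≠ 0 → ArrowTo (i.1 (pr b)) (i.1 b) →
      WRel δ (psi b ^ 2 * e i) ((y b - y (pr b)) * e i)
  | psi_sq_from (b : Fin n) (i : δ) : b ≠ 0 → ArrowFrom (i.1 (pr b)) (i.1 b) →
      WRel δ (psi b ^ 2 * e i) ((y (pr b) - y b) * e i)
  | psi_sq_both (b : Fin n) (i : δ) : b ≠ 0 → ArrowBoth (i.1 (pr b)) (i.1 b) →
      WRel δ (psi b ^ 2 * e i) ((y b - y (pr b)) * (y (pr b) - y b) * e i)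
  | braid_to (b c : Fin n) (i : δ) : b ≠ 0 → c.val = b.val + 1 →
      i.1 (pr b) = i.1 c → ArrowTo (i.1 c) (i.1 b) →
      WRel δ ((psi b * psi c * psi b - psi c * psi b * psi c) * e i) (e i)
  | braid_from (b c : Fin n) (i : δ) : b ≠ 0 → c.val = b.val + 1 →
      i.1 (pr b) = i.1 c → ArrowFrom (i.1 c) (i.1 b) →
      WRel δ ((psi b * psi c * psi b - psi c * psi b * psi c) * e i) (-e i)
  | braid_both (b c : Fin n) (i : δ) : b ≠ 0 → c.val = b.val + 1 →
      i.1 (pr b) = i.1 c → ArrowBoth (i.1 c) (i.1 b) →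
      WRel δ ((psi b * psi c * psi b - psi c * psi b * psi c) * e i)
        ((y c - 2 * y b + y (pr b)) * e i)
  | braid_else (b c : Fin n) (i : δ) : b ≠ 0 → c.val = b.val + 1 →
      ¬ (i.1 (pr b) = i.1 c ∧
        (ArrowTo (i.1 c) (i.1 b) ∨ ArrowFrom (i.1 c) (i.1 b) ∨ ArrowBoth (i.1 c) (i.1 b))) →
      WRel δ ((psi b * psi c * psi b - psi c * psi b * psi c) * e i) 0
  | psi0_y_eq (t j : Fin n) (i : δ) : t.val = 1 → (j = 0 ∨ j = t) → (i.1 0)⁻¹ = i.1 t →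
      WRel δ (psi 0 * y j * e i) ((-(y (Equiv.swap 0 t j) * psi 0) + 1) * e i)
  | psi0_y_ne (t j : Fin n) (i : δ) : t.val = 1 → (j = 0 ∨ j = t) → (i.1 0)⁻¹ ≠ i.1 t →
      WRel δ (psi 0 * y j * e i) (-(y (Equiv.swap 0 t j) * psi 0) * e i)
  | psi0_y_else (j : Fin n) (i : δ) : 1 < j.val →
      WRel δ (psi 0 * y j * e i) (y j * psi 0 * e i)
  | psi0_comm (b : Fin n) : (b.val = 1 ∨ 2 < b.val) →
      WRel δ (psi 0 * psi b) (psi b * psi 0)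
  | psi0_sq_eq (t : Fin n) (i : δ) : t.val = 1 → (i.1 0)⁻¹ = i.1 t →
      WRel δ (psi 0 ^ 2 * e i) 0
  | psi0_sq_none (t : Fin n) (i : δ) : t.val = 1 → NoArrow (i.1 0)⁻¹ (i.1 t) →
      WRel δ (psi 0 ^ 2 * e i) (e i)
  | psi0_sq_to (t : Fin n) (i : δ) : t.val = 1 → ArrowTo (i.1 0)⁻¹ (i.1 t) →
      WRel δ (psi 0 ^ 2 * e i) ((y 0 + y t) * e i)
  | psi0_sq_from (t : Fin n) (i : δ) : t.val = 1 → ArrowFrom (i.1 0)⁻¹ (i.1 t) →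
      WRel δ (psi 0 ^ 2 * e i) (-(y 0 + y t) * e i)
  | psi0_sq_both (t : Fin n) (i : δ) : t.val = 1 → ArrowBoth (i.1 0)⁻¹ (i.1 t) →
      WRel δ (psi 0 ^ 2 * e i) (-(y 0 + y t) ^ 2 * e i)
  | braid0_to (t u : Fin n) (i : δ) : t.val = 1 → u.val = 2 →
      (i.1 0)⁻¹ = i.1 u → ArrowTo (i.1 u) (i.1 t) →
      WRel δ ((psi 0 * psi u * psi 0 - psi u * psi 0 * psi u) * e i) (e i)
  | braid0_from (t u : Fin n) (i : δ) : t.val = 1 → u.val = 2 →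
      (i.1 0)⁻¹ = i.1 u → ArrowFrom (i.1 u) (i.1 t) →
      WRel δ ((psi 0 * psi u * psi 0 - psi u * psi 0 * psi u) * e i) (-e i)
  | braid0_both (t u : Fin n) (i : δ) : t.val = 1 → u.val = 2 →
      (i.1 0)⁻¹ = i.1 u → ArrowBoth (i.1 u) (i.1 t) →
      WRel δ ((psi 0 * psi u * psi 0 - psi u * psi 0 * psi u) * e i)
        ((y u - 2 * y t - y 0) * e i)
  | braid0_else (t u : Fin n) (i : δ) : t.val = 1 → u.val = 2 →
      ¬ ((i.1 0)⁻¹ = i.1 u ∧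
        (ArrowTo (i.1 u) (i.1 t) ∨ ArrowFrom (i.1 u) (i.1 t) ∨ ArrowBoth (i.1 u) (i.1 t))) →
      WRel δ ((psi 0 * psi u * psi 0 - psi u * psi 0 * psi u) * e i) 0

/-- The algebra `V_λ^β`: generators `ψ_a`, `y_j`, `e(i)` and relations `VRel`. -/
def VAlg (β : Finset (Fin n → Vertex q lam)) : Type _ := RingQuot (VRel β)

noncomputable instance (β : Finset (Fin n → Vertex q lam)) : Ring (VAlg β) :=
  inferInstanceAs (Ring (RingQuot (VRel β)))

noncomputable instance (β : Finset (Fin n → Vertex q lam)) : Algebra K (VAlg β) :=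
  inferInstanceAs (Algebra K (RingQuot (VRel β)))

/-- The algebra `W_λ^δ`: generators `Ψ_a`, `y_j`, `e(i)` and relations `WRel`. -/
def WAlg (δ : Finset (Fin n → Vertex q lam)) : Type _ := RingQuot (WRel δ)

noncomputable instance (δ : Finset (Fin n → Vertex q lam)) : Ring (WAlg δ) :=
  inferInstanceAs (Ring (RingQuot (WRel δ)))

noncomputable instance (δ : Finset (Fin n → Vertex q lam)) : Algebra K (WAlg δ) :=
  inferInstanceAs (Algebra K (RingQuot (WRel δ)))

/-- The quotient map from the free algebra to `V_λ^β`. -/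
noncomputable def toV (β : Finset (Fin n → Vertex q lam)) : Free β →ₐ[K] VAlg β :=
  RingQuot.mkAlgHom K (VRel β)

/-- The quotient map from the free algebra to `W_λ^δ`. -/
noncomputable def toW (δ : Finset (Fin n → Vertex q lam)) : Free δ →ₐ[K] WAlg δ :=
  RingQuot.mkAlgHom K (WRel δ)

/-- The cyclotomic relations `y_1^{m(i_1)} e(i) = 0`, `i ∈ β`, in `V_λ^β`. -/
inductive VCycRel (m : Vertex q lam →₀ ℕ) (β : Finset (Fin n → Vertex q lam)) :
    VAlg β → VAlg β → Prop
  | cyc (i : β) : VCycRel m β (toV β (y 0) ^ m (i.1 0) * toV β (e i)) 0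

/-- The cyclotomic relations `y_1^{m(i_1)} e(i) = 0`, `i ∈ δ`, in `W_λ^δ`. -/
inductive WCycRel (m : Vertex q lam →₀ ℕ) (δ : Finset (Fin n → Vertex q lam)) :
    WAlg δ → WAlg δ → Prop
  | cyc (i : δ) : WCycRel m δ (toW δ (y 0) ^ m (i.1 0) * toW δ (e i)) 0

/-- The cyclotomic quotient `V_{λ,m}^β` of `V_λ^β`. -/
def VCyc (m : Vertex q lam →₀ ℕ) (β : Finset (Fin n → Vertex q lam)) : Type _ :=
  RingQuot (VCycRel m β)

noncomputable instance (m : Vertex q lam →₀ ℕ) (β : Finset (Fin n → Vertex q lam)) :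
    Ring (VCyc m β) :=
  inferInstanceAs (Ring (RingQuot (VCycRel m β)))

noncomputable instance (m : Vertex q lam →₀ ℕ) (β : Finset (Fin n → Vertex q lam)) :
    Algebra K (VCyc m β) :=
  inferInstanceAs (Algebra K (RingQuot (VCycRel m β)))

/-- The cyclotomic quotient `W_{λ,m}^δ` of `W_λ^δ`. -/
def WCyc (m : Vertex q lam →₀ ℕ) (δ : Finset (Fin n → Vertex q lam)) : Type _ :=
  RingQuot (WCycRel m δ)

noncomputable instance (m : Vertex q lam →₀ ℕ) (δ : Finset (Fin n → Vertex q lam)) :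
    Ring (WCyc m δ) :=
  inferInstanceAs (Ring (RingQuot (WCycRel m δ)))

noncomputable instance (m : Vertex q lam →₀ ℕ) (δ : Finset (Fin n → Vertex q lam)) :
    Algebra K (WCyc m δ) :=
  inferInstanceAs (Algebra K (RingQuot (WCycRel m δ)))

/-- The quotient map from `V_λ^β` to `V_{λ,m}^β`. -/
noncomputable def toVCyc (m : Vertex q lam →₀ ℕ) (β : Finset (Fin n → Vertex q lam)) :
    VAlg β →ₐ[K] VCyc m β :=
  RingQuot.mkAlgHom K (VCycRel m β)

/-! ## The involution `ρ` and the involution it induces on the cyclotomic quotient -/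

/-- `ψ_0 ↦ -ψ_0`, every other generator is fixed: the values of `ρ` on generators. -/
noncomputable def rhoGen (β : Finset (Fin n → Vertex q lam)) : Gen β → VAlg β
  | Gen.psi a => if a = 0 then -toV β (psi a) else toV β (psi a)
  | Gen.y j => toV β (y j)
  | Gen.e i => toV β (e i)

/-- The values of `ρ` on the free algebra. -/
noncomputable def rhoFree (β : Finset (Fin n → Vertex q lam)) : Free β →ₐ[K] VAlg β :=
  FreeAlgebra.lift K (rhoGen β)

theorem toV_rel {β : Finset (Fin n → Vertex q lam)} {a b : Free β} (h : VRel β a b) :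
    toV β a = toV β b :=
  RingQuot.mkAlgHom_rel K h

theorem rhoFree_psi_zero (β : Finset (Fin n → Vertex q lam)) :
    rhoFree β (psi 0) = -toV β (psi 0) := by
  simp [rhoFree, psi, rhoGen]

theorem rhoFree_psi {β : Finset (Fin n → Vertex q lam)} {a : Fin n} (ha : a ≠ 0) :
    rhoFree β (psi a) = toV β (psi a) := by
  simp [rhoFree, psi, rhoGen, ha]

theorem rhoFree_y (β : Finset (Fin n → Vertex q lam)) (j : Fin n) :
    rhoFree β (y j) = toV β (y j) := by
  simp [rhoFree, y, rhoGen]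

theorem rhoFree_e (β : Finset (Fin n → Vertex q lam)) (i : β) :
    rhoFree β (e i) = toV β (e i) := by
  simp [rhoFree, e, rhoGen]

theorem rhoFree_rel {β : Finset (Fin n → Vertex q lam)} ⦃a b : Free β⦄ (h : VRel β a b) :
    rhoFree β a = rhoFree β b := by
  have key := toV_rel h
  cases h with
  | psi_e a i j hij =>
    by_cases ha : a = 0
    · subst ha
      simpa [rhoFree_psi_zero, rhoFree_e] using key
    · simpa [rhoFree_psi ha, rhoFree_e] using key
  | psi_comm a b hb hab =>
    by_cases ha : a = 0
    · subst ha
      simpa [rhoFree_psi_zero, rhoFree_psi hb] using key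
    · simpa [rhoFree_psi ha, rhoFree_psi hb] using key
  | braid_to b c i hb hc _ _ =>
    have hc0 : c ≠ 0 := by rintro rfl; simp at hc
    simpa [rhoFree_psi hb, rhoFree_psi hc0, rhoFree_e, rhoFree_y] using key
  | braid_from b c i hb hc _ _ =>
    have hc0 : c ≠ 0 := by rintro rfl; simp at hc
    simpa [rhoFree_psi hb, rhoFree_psi hc0, rhoFree_e, rhoFree_y] using key
  | braid_both b c i hb hc _ _ =>
    have hc0 : c ≠ 0 := by rintro rfl; simp at hc
    simpa [two_mul, rhoFree_psi hb, rhoFree_psi hc0, rhoFree_e, rhoFree_y] using key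
  | braid_else b c i hb hc _ =>
    have hc0 : c ≠ 0 := by rintro rfl; simp at hc
    simpa [rhoFree_psi hb, rhoFree_psi hc0, rhoFree_e, rhoFree_y] using key
  | braid0 b hb =>
    have hb0 : b ≠ 0 := by rintro rfl; simp at hb
    simpa [rhoFree_psi_zero, rhoFree_psi hb0, neg_mul, mul_neg, neg_sq] using key
  | psi0_y1 =>
    simp only [map_add, map_mul, map_zero, rhoFree_psi_zero, rhoFree_y] at key ⊢
    rw [neg_mul, mul_neg, ← neg_add, key, neg_zero]
  | sum_e => simpa [rhoFree_e] using key
  | e_mul_self i => simpa [rhoFree_e] using key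
  | e_mul_ne i j hij => simpa [rhoFree_e] using key
  | y_comm j k => simpa [rhoFree_y] using key
  | y_e j i => simpa [rhoFree_y, rhoFree_e] using key
  | psi_y_left b i hb _ => simpa [rhoFree_psi hb, rhoFree_y, rhoFree_e] using key
  | psi_y_right b i hb _ => simpa [rhoFree_psi hb, rhoFree_y, rhoFree_e] using key
  | psi_y_else b j i hb _ => simpa [rhoFree_psi hb, rhoFree_y, rhoFree_e] using key
  | psi_sq_eq b i hb _ => simpa [rhoFree_psi hb, rhoFree_y, rhoFree_e] using key
  | psi_sq_none b i hb _ => simpa [rhoFree_psi hb, rhoFree_y, rhoFree_e] using key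
  | psi_sq_to b i hb _ => simpa [rhoFree_psi hb, rhoFree_y, rhoFree_e] using key
  | psi_sq_from b i hb _ => simpa [rhoFree_psi hb, rhoFree_y, rhoFree_e] using key
  | psi_sq_both b i hb _ => simpa [rhoFree_psi hb, rhoFree_y, rhoFree_e] using key
  | psi0_y j hj => simpa [rhoFree_psi_zero, rhoFree_y] using key
  | psi0_sq => simpa [rhoFree_psi_zero] using key

/-- `ρ` as an algebra endomorphism of `V_λ^β`. -/
noncomputable def rhoHom (β : Finset (Fin n → Vertex q lam)) : VAlg β →ₐ[K] VAlg β :=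
  RingQuot.liftAlgHom K ⟨rhoFree β, rhoFree_rel⟩

theorem rhoHom_toV (β : Finset (Fin n → Vertex q lam)) (x : Free β) :
    rhoHom β (toV β x) = rhoFree β x :=
  RingQuot.liftAlgHom_mkAlgHom_apply K (rhoFree β) rhoFree_rel x

theorem rhoHom_comp_rhoHom (β : Finset (Fin n → Vertex q lam)) :
    (rhoHom β).comp (rhoHom β) = AlgHom.id K (VAlg β) := by
  apply RingQuot.ringQuot_ext'
  apply FreeAlgebra.hom_ext
  funext g
  change rhoHom β (rhoHom β (toV β (FreeAlgebra.ι K g))) = toV β (FreeAlgebra.ι K g)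
  rw [rhoHom_toV]
  cases g with
  | psi a =>
    change rhoHom β (rhoFree β (psi a)) = toV β (psi a)
    by_cases ha : a = 0
    · subst ha
      rw [rhoFree_psi_zero, map_neg, rhoHom_toV, rhoFree_psi_zero, neg_neg]
    · rw [rhoFree_psi ha, rhoHom_toV, rhoFree_psi ha]
  | y j =>
    change rhoHom β (rhoFree β (y j)) = toV β (y j)
    rw [rhoFree_y, rhoHom_toV, rhoFree_y]
  | e i =>
    change rhoHom β (rhoFree β (e i)) = toV β (e i)
    rw [rhoFree_e, rhoHom_toV, rhoFree_e]

/-- The involutive automorphism `ρ` of `V_λ^β`: `ψ_0 ↦ -ψ_0`, all other generators fixed. -/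
noncomputable def rho (β : Finset (Fin n → Vertex q lam)) : VAlg β ≃ₐ[K] VAlg β :=
  AlgEquiv.ofAlgHom (rhoHom β) (rhoHom β) (rhoHom_comp_rhoHom β) (rhoHom_comp_rhoHom β)

theorem toVCyc_rho_rel (m : Vertex q lam →₀ ℕ) (β : Finset (Fin n → Vertex q lam))
    ⦃a b : VAlg β⦄ (h : VCycRel m β a b) :
    (toVCyc m β).comp (rhoHom β) a = (toVCyc m β).comp (rhoHom β) b := by
  have key : toVCyc m β a = toVCyc m β b := RingQuot.mkAlgHom_rel K h
  cases h with
  | cyc i =>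
    rw [AlgHom.comp_apply, AlgHom.comp_apply, map_mul, map_pow, rhoHom_toV, rhoHom_toV, rhoFree_y,
      rhoFree_e, map_zero]
    exact key

/-- The endomorphism of `V_{λ,m}^β` induced by `ρ`. -/
noncomputable def rhoTildeHom (m : Vertex q lam →₀ ℕ) (β : Finset (Fin n → Vertex q lam)) :
    VCyc m β →ₐ[K] VCyc m β :=
  RingQuot.liftAlgHom K ⟨(toVCyc m β).comp (rhoHom β), toVCyc_rho_rel m β⟩

theorem rhoTildeHom_toVCyc (m : Vertex q lam →₀ ℕ) (β : Finset (Fin n → Vertex q lam))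
    (x : VAlg β) : rhoTildeHom m β (toVCyc m β x) = toVCyc m β (rho β x) :=
  RingQuot.liftAlgHom_mkAlgHom_apply K ((toVCyc m β).comp (rhoHom β)) (toVCyc_rho_rel m β) x

theorem rhoTildeHom_comp (m : Vertex q lam →₀ ℕ) (β : Finset (Fin n → Vertex q lam)) :
    (rhoTildeHom m β).comp (rhoTildeHom m β) = AlgHom.id K (VCyc m β) := by
  apply RingQuot.ringQuot_ext'
  apply AlgHom.ext
  intro x
  change rhoTildeHom m β (rhoTildeHom m β (toVCyc m β x)) = toVCyc m β x
  rw [rhoTildeHom_toVCyc, rhoTildeHom_toVCyc]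
  exact congrArg (toVCyc m β) (DFunLike.congr_fun (rhoHom_comp_rhoHom β) x)

/-- The involutive automorphism `ρ̃` of `V_{λ,m}^β` induced by `ρ`, i.e. `ρ̃(x + J) = ρ(x) + J`. -/
noncomputable def rhoTilde (m : Vertex q lam →₀ ℕ) (β : Finset (Fin n → Vertex q lam)) :
    VCyc m β ≃ₐ[K] VCyc m β :=
  AlgEquiv.ofAlgHom (rhoTildeHom m β) (rhoTildeHom m β) (rhoTildeHom_comp m β)
    (rhoTildeHom_comp m β)

end Algebras

/-- The subalgebra `A^θ = {x ∈ A | θ x = x}` of fixed points of an automorphism `θ`. -/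
def fixedPoints {K A : Type*} [CommSemiring K] [Semiring A] [Algebra K A] (θ : A ≃ₐ[K] A) :
    Subalgebra K A :=
  AlgHom.equalizer θ.toAlgHom (AlgHom.id K A)

end QuiverHeckeBD

namespace QuiverHeckeBD

open Free

/-! ### Indices in `Fin n` and the action of `r_a`, `s_a` on tuples -/

section Positions

variable {n : ℕ} [NeZero n]

/-! The algebra `V` behaves like the crossed product of `W` with a group of order two generated by
`ψ_0`, and `ρ̃` is its sign grading; the fixed points are therefore the even part, a copy of `W`.

The map sends `Ψ_0` to `ψ_0 ψ_1 ψ_0` and keeps the names of all other generators. To see that it is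
well defined, consider the diagram involution `twist`: exchange `Ψ_0` and `Ψ_1`, send `y_1` to
`-y_1`, and let `r_0` act on the idempotents. The presentation of `W` amounts to the type A
relations (`ARel`), their images under `twist`, and `Ψ_0 Ψ_1 = Ψ_1 Ψ_0` (`respects_WRel_twist`,
`respects_WRel_of_typeA`). In `V`, conjugation by `ψ_0` realises `twist` (`psi_zero_mul_embedFree`),
so the twisted relations follow from the untwisted ones, and the commutation is the braid relation
of type B (`embedFree_respects`).

For injectivity, symmetry of `m` lets `twist` descend to an involution `σ` of the cyclotomic
quotient of `W`. The crossed product with `σ` acts by 2 × 2 matrices over that quotient, `w` as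
`diag(w, σ w)` and `ψ_0` as the swap matrix. This gives a homomorphism on `V`
(`exists_hom_crossedProduct`) whose composite with the map from `W` is `w ↦ diag(w, σ w)`, which is
injective.

For the image, `V = A + A ψ_0` with `A` the image of `W` (`exists_decomposition`). Since `ρ̃` fixes
`A` and negates `ψ_0`, a fixed element has its odd component equal to its own negative, hence zero
in characteristic different from 2 (`mem_range_embedFree_of_fixed`). -/

theorem val_one_fin (hn : 2 ≤ n) : (1 : Fin n).val = 1 := by
  rw [Fin.val_one', Nat.mod_eq_of_lt hn]

theorem eq_one_of_val {t : Fin n} (ht : t.val = 1) : t = 1 := by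
  apply Fin.ext
  have := t.2
  rw [val_one_fin (by omega), ht]

theorem one_ne_zero_fin (hn : 2 ≤ n) : (1 : Fin n) ≠ 0 := by
  intro h
  have := congrArg Fin.val h
  rw [val_one_fin hn] at this
  simp at this

theorem pr_one (hn : 2 ≤ n) : pr (1 : Fin n) = 0 := by
  apply Fin.ext
  simp only [pr, val_one_fin hn, Fin.val_zero]

theorem two_le_val {b : Fin n} (h0 : b ≠ 0) (h1 : b ≠ 1) : 2 ≤ b.val := by
  have h0' : b.val ≠ 0 := fun h => h0 (Fin.ext (by simpa using h))
  have h1' : b.val ≠ 1 := fun h => h1 (eq_one_of_val h)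
  omega

theorem pr_ne_zero {b : Fin n} (hb : 2 ≤ b.val) : pr b ≠ 0 := by
  intro h
  have := congrArg Fin.val h
  simp [pr] at this
  omega

theorem ne_zero_of_two_le {b : Fin n} (hb : 2 ≤ b.val) : b ≠ 0 := by
  rintro rfl
  simp at hb

theorem ne_one_of_two_le {b : Fin n} (hb : 2 ≤ b.val) : b ≠ 1 := by
  rintro rfl
  have := (1 : Fin n).2
  rw [val_one_fin (by omega)] at hb
  omega

variable {V : Type*} [InvolutiveInv V]

theorem r_apply_of_ne {b : Fin n} (hb : b ≠ 0) (i : Fin n → V) (j : Fin n) :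
    r b i j = i (Equiv.swap (pr b) b j) := by
  change rFun b i j = _
  simp [rFun, hb]

theorem r_zero_apply_zero (i : Fin n → V) : r (0 : Fin n) i 0 = (i 0)⁻¹ := by
  change rFun 0 i 0 = _
  simp [rFun]

theorem r_zero_apply {j : Fin n} (hj : j ≠ 0) (i : Fin n → V) : r (0 : Fin n) i j = i j := by
  change rFun 0 i j = _
  simp [rFun, hj]

theorem r_r (a : Fin n) (i : Fin n → V) : r a (r a i) = i := rFun_involutive a i

theorem s_of_ne {b : Fin n} (hb : b ≠ 0) (i : Fin n → V) : s b i = r b i := by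
  funext j
  rw [r_apply_of_ne hb]
  simp [s, hb]

/-- The shadow on tuples of `Ψ_0 = ψ_0 ψ_1 ψ_0`: it turns the relation between `Ψ_0` and `e(i)` into
the twist of the one between `Ψ_1` and `e(i)`. -/
theorem s_zero (hn : 2 ≤ n) (i : Fin n → V) : s 0 i = r 0 (r 1 (r 0 i)) := by
  have h10 := one_ne_zero_fin hn
  funext j
  simp only [s, if_pos]
  by_cases h0 : j = 0
  · subst h0
    simp [r_zero_apply_zero, r_apply_of_ne h10, pr_one hn, r_zero_apply h10]
  by_cases h1 : j = 1
  · subst h1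
    rw [if_neg (by rw [val_one_fin hn]; omega), if_pos (val_one_fin hn)]
    simp [r_zero_apply h10, r_apply_of_ne h10, pr_one hn, r_zero_apply_zero]
  · have h2 := two_le_val h0 h1
    rw [if_neg (by omega), if_neg (by omega), r_zero_apply h0, r_apply_of_ne h10, pr_one hn,
      Equiv.swap_apply_of_ne_of_ne h0 h1, r_zero_apply h0]

/-- For such `b` the exchanged positions avoid the first one. This is what allows the twist to fix
`ψ_b` while moving the idempotents by `r_0`. -/
theorem r_zero_comm {b : Fin n} (hb : 2 ≤ b.val) (i : Fin n → V) :
    r 0 (r b i) = r b (r 0 i) := by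
  have hb0 := ne_zero_of_two_le hb
  have hp0 := pr_ne_zero hb
  funext j
  by_cases h0 : j = 0
  · subst h0
    rw [r_zero_apply_zero, r_apply_of_ne hb0, r_apply_of_ne hb0,
      Equiv.swap_apply_of_ne_of_ne hp0.symm hb0.symm, r_zero_apply_zero]
  · have : Equiv.swap (pr b) b j ≠ 0 := by
      intro h
      rw [Equiv.swap_apply_eq_iff, Equiv.swap_apply_of_ne_of_ne hp0.symm hb0.symm] at h
      exact h0 h
    rw [r_zero_apply h0, r_apply_of_ne hb0, r_apply_of_ne hb0, r_zero_apply this]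

theorem r_mem_orbitB (a : Fin n) {i j : Fin n → V} (hj : j ∈ orbitB i) : r a j ∈ orbitB i := by
  obtain ⟨w, hw, rfl⟩ := hj
  exact ⟨r a * w, mul_mem (Subgroup.subset_closure ⟨a, rfl⟩) hw, rfl⟩

end Positions

/-! ### The type A relations shared by both algebras -/

section TypeA

variable {K : Type*} [Field K] {q : Kˣ} {l : ℕ} {lam : Fin l → Kˣ} {n : ℕ}
  {β : Finset (Fin n → Vertex q lam)} {A B : Type*} [Ring A] [Algebra K A]
  [Ring B] [Algebra K B]

/-- An algebra homomorphism on the free algebra respects the relations `R`. -/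
def Respects (R : Free β → Free β → Prop) (F : Free β →ₐ[K] A) : Prop :=
  ∀ ⦃a b⦄, R a b → F a = F b

theorem Respects.comp {R : Free β → Free β → Prop} {F : Free β →ₐ[K] A} (h : Respects R F)
    (g : A →ₐ[K] B) : Respects R (g.comp F) := fun _ _ hab => congrArg g (h hab)

variable [NeZero n]

/-- The relations among `ψ_b` (`b ≠ 0`), `y_j`, `e(i)` that the algebras `V` and `W` have in
common. -/
inductive ARel (β : Finset (Fin n → Vertex q lam)) : Free β → Free β → Prop
  | sum_e : ARel β (∑ i : β, e i) 1
  | e_mul_self (i : β) : ARel β (e i * e i) (e i)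
  | e_mul_ne (i j : β) : i ≠ j → ARel β (e i * e j) 0
  | y_comm (j k : Fin n) : ARel β (y j * y k) (y k * y j)
  | y_e (j : Fin n) (i : β) : ARel β (y j * e i) (e i * y j)
  | psi_e (b : Fin n) (i j : β) : b ≠ 0 → j.1 = r b i.1 → ARel β (psi b * e i) (e j * psi b)
  | psi_y_left (b : Fin n) (i : β) : b ≠ 0 → i.1 (pr b) = i.1 b →
      ARel β ((psi b * y (pr b) - y b * psi b) * e i) (-e i)
  | psi_y_right (b : Fin n) (i : β) : b ≠ 0 → i.1 (pr b) = i.1 b →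
      ARel β ((psi b * y b - y (pr b) * psi b) * e i) (e i)
  | psi_y_else (b j : Fin n) (i : β) : b ≠ 0 → ¬ ((j = pr b ∨ j = b) ∧ i.1 (pr b) = i.1 b) →
      ARel β ((psi b * y j - y (Equiv.swap (pr b) b j) * psi b) * e i) 0
  | psi_comm (a b : Fin n) : a ≠ 0 → b ≠ 0 → 1 < |(a.val : ℤ) - b.val| →
      ARel β (psi a * psi b) (psi b * psi a)
  | psi_sq_eq (b : Fin n) (i : β) : b ≠ 0 → i.1 (pr b) = i.1 b →
      ARel β (psi b ^ 2 * e i) 0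
  | psi_sq_none (b : Fin n) (i : β) : b ≠ 0 → NoArrow (i.1 (pr b)) (i.1 b) →
      ARel β (psi b ^ 2 * e i) (e i)
  | psi_sq_to (b : Fin n) (i : β) : b ≠ 0 → ArrowTo (i.1 (pr b)) (i.1 b) →
      ARel β (psi b ^ 2 * e i) ((y b - y (pr b)) * e i)
  | psi_sq_from (b : Fin n) (i : β) : b ≠ 0 → ArrowFrom (i.1 (pr b)) (i.1 b) →
      ARel β (psi b ^ 2 * e i) ((y (pr b) - y b) * e i)
  | psi_sq_both (b : Fin n) (i : β) : b ≠ 0 → ArrowBoth (i.1 (pr b)) (i.1 b) →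
      ARel β (psi b ^ 2 * e i) ((y b - y (pr b)) * (y (pr b) - y b) * e i)
  | braid_to (b c : Fin n) (i : β) : b ≠ 0 → c.val = b.val + 1 →
      i.1 (pr b) = i.1 c → ArrowTo (i.1 c) (i.1 b) →
      ARel β ((psi b * psi c * psi b - psi c * psi b * psi c) * e i) (e i)
  | braid_from (b c : Fin n) (i : β) : b ≠ 0 → c.val = b.val + 1 →
      i.1 (pr b) = i.1 c → ArrowFrom (i.1 c) (i.1 b) →
      ARel β ((psi b * psi c * psi b - psi c * psi b * psi c) * e i) (-e i)
  | braid_both (b c : Fin n) (i : β) : b ≠ 0 → c.val = b.val + 1 →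
      i.1 (pr b) = i.1 c → ArrowBoth (i.1 c) (i.1 b) →
      ARel β ((psi b * psi c * psi b - psi c * psi b * psi c) * e i)
        ((y c - 2 * y b + y (pr b)) * e i)
  | braid_else (b c : Fin n) (i : β) : b ≠ 0 → c.val = b.val + 1 →
      ¬ (i.1 (pr b) = i.1 c ∧
        (ArrowTo (i.1 c) (i.1 b) ∨ ArrowFrom (i.1 c) (i.1 b) ∨ ArrowBoth (i.1 c) (i.1 b))) →
      ARel β ((psi b * psi c * psi b - psi c * psi b * psi c) * e i) 0

/-- Homomorphisms that agree on `ψ_b` (`b ≠ 0`), `y_j` and `e(i)` satisfy the same type `A`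
relations. -/
theorem Respects.congr_typeA {F G : Free β →ₐ[K] A} (h : Respects (ARel β) F)
    (hpsi : ∀ b : Fin n, b ≠ 0 → G (psi b) = F (psi b)) (hy : ∀ j, G (y j) = F (y j))
    (he : ∀ i, G (e i) = F (e i)) : Respects (ARel β) G := by
  intro a b hab
  have key := h hab
  cases hab with
  | braid_to b c i hb hc _ _ =>
    have hc0 : c ≠ 0 := by rintro rfl; simp at hc
    simpa [hpsi b hb, hpsi c hc0, hy, he] using key
  | braid_from b c i hb hc _ _ =>
    have hc0 : c ≠ 0 := by rintro rfl; simp at hc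
    simpa [hpsi b hb, hpsi c hc0, hy, he] using key
  | braid_both b c i hb hc _ _ =>
    have hc0 : c ≠ 0 := by rintro rfl; simp at hc
    simpa [two_mul, hpsi b hb, hpsi c hc0, hy, he] using key
  | braid_else b c i hb hc _ =>
    have hc0 : c ≠ 0 := by rintro rfl; simp at hc
    simpa [hpsi b hb, hpsi c hc0, hy, he] using key
  | psi_comm a b ha hb _ => simpa [hpsi a ha, hpsi b hb] using key
  | psi_e b i j hb _ => simpa [hpsi b hb, he] using key
  | psi_y_left b i hb _ => simpa [hpsi b hb, hy, he] using key
  | psi_y_right b i hb _ => simpa [hpsi b hb, hy, he] using key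
  | psi_y_else b j i hb _ => simpa [hpsi b hb, hy, he] using key
  | psi_sq_eq b i hb _ => simpa [hpsi b hb, hy, he] using key
  | psi_sq_none b i hb _ => simpa [hpsi b hb, hy, he] using key
  | psi_sq_to b i hb _ => simpa [hpsi b hb, hy, he] using key
  | psi_sq_from b i hb _ => simpa [hpsi b hb, hy, he] using key
  | psi_sq_both b i hb _ => simpa [hpsi b hb, hy, he] using key
  | sum_e => simpa [he] using key
  | e_mul_self i => simpa [he] using key
  | e_mul_ne i j hij => simpa [he] using key
  | y_comm j k => simpa [hy] using key
  | y_e j i => simpa [hy, he] using key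

/-- Separates the type A relations from those on `ψ_0`. The latter say that `ψ_0` is an involution
acting by conjugation as the twist, and the last condition, the braid relation regrouped, says that
`ψ_0 ψ_1 ψ_0` commutes with `ψ_1`. -/
theorem respects_VRel_iff {F : Free β →ₐ[K] A} :
    Respects (VRel β) F ↔ Respects (ARel β) F ∧
      (∀ i j : β, j.1 = r 0 i.1 → F (psi 0) * F (e i) = F (e j) * F (psi 0)) ∧
      (∀ b : Fin n, 2 ≤ b.val → F (psi 0) * F (psi b) = F (psi b) * F (psi 0)) ∧
      F (psi 0) * F (y 0) + F (y 0) * F (psi 0) = 0 ∧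
      (∀ j : Fin n, j ≠ 0 → F (psi 0) * F (y j) = F (y j) * F (psi 0)) ∧
      F (psi 0) * F (psi 0) = 1 ∧
      (∀ b : Fin n, b.val = 1 →
        F (psi 0) * F (psi b) * F (psi 0) * F (psi b) =
          F (psi b) * (F (psi 0) * F (psi b) * F (psi 0))) := by
  constructor
  · intro h
    refine ⟨?_, fun i j hij => by simpa using h (.psi_e 0 i j hij), fun b hb => ?_,
      by simpa using h .psi0_y1, fun j hj => by simpa using h (.psi0_y j hj),
      by simpa [sq] using h .psi0_sq,
      fun b hb => by simpa [sq, sub_eq_zero, mul_assoc] using h (.braid0 b hb)⟩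
    · intro a b hab
      apply h
      cases hab <;> constructor <;> assumption
    · have : b ≠ 0 := ne_zero_of_two_le hb
      simpa using h (.psi_comm 0 b this (by
        rw [Fin.val_zero, Nat.cast_zero, zero_sub, abs_neg, Nat.abs_cast]
        exact_mod_cast hb))
  · rintro ⟨h, he, hcomm, hy0, hy, hsq, hbr⟩ a b hab
    cases hab with
    | psi_e a i j hij =>
      by_cases ha : a = 0
      · subst ha
        simpa using he i j hij
      · exact h (.psi_e a i j ha hij)
    | psi_comm a b hb hab =>
      by_cases ha : a = 0
      · subst ha
        rw [Fin.val_zero, Nat.cast_zero, zero_sub, abs_neg, Nat.abs_cast] at hab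
        simpa using hcomm b (by exact_mod_cast hab)
      · exact h (.psi_comm a b ha hb hab)
    | psi0_y1 => simpa using hy0
    | psi0_y j hj => simpa using hy j hj
    | psi0_sq => simpa [sq] using hsq
    | braid0 b hb => simpa [sq, sub_eq_zero, mul_assoc] using hbr b hb
    | _ => apply h; constructor <;> assumption

end TypeA

/-! ### The diagram involution and the presentation of `W` -/

section Twist

variable {K : Type*} [Field K] {q : Kˣ} {l : ℕ} {lam : Fin l → Kˣ} {n : ℕ} [NeZero n]
  {β : Finset (Fin n → Vertex q lam)} {A : Type*} [Ring A] [Algebra K A]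

/-- The action of `r_0` on a stable set of tuples. -/
def flip (hβ : ∀ i ∈ β, r 0 i ∈ β) (i : β) : β := ⟨r 0 i.1, hβ i.1 i.2⟩

variable (hβ : ∀ i ∈ β, r 0 i ∈ β)

theorem flip_flip (i : β) : flip hβ (flip hβ i) = i := Subtype.ext (r_r 0 i.1)

theorem flip_zero (i : β) : (flip hβ i).1 0 = (i.1 0)⁻¹ := r_zero_apply_zero i.1

theorem flip_apply {j : Fin n} (hj : j ≠ 0) (i : β) : (flip hβ i).1 j = i.1 j :=
  r_zero_apply hj i.1

theorem flip_injective : Function.Injective (flip hβ) :=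
  Function.LeftInverse.injective (flip_flip hβ)

theorem sum_flip {M : Type*} [AddCommMonoid M] (f : β → M) :
    ∑ i, f (flip hβ i) = ∑ i, f i :=
  Equiv.sum_comp (Function.Involutive.toPerm (flip hβ) (flip_flip hβ)) f

/-- The values on generators of the diagram involution of the algebra `W`. -/
noncomputable def twistGen : Gen β → Free β
  | Gen.psi a => psi (Equiv.swap 0 1 a)
  | Gen.y j => if j = 0 then -y j else y j
  | Gen.e i => e (flip hβ i)

/-- The endomorphism of the free algebra that exchanges `ψ_0` and `ψ_1`, changes the sign of `y_1`
and lets `r_0` act on the tuples. -/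
noncomputable def twist : Free β →ₐ[K] Free β := FreeAlgebra.lift K (twistGen hβ)

theorem twist_psi (a : Fin n) : twist hβ (psi a) = psi (Equiv.swap 0 1 a) := by
  simp [twist, psi, twistGen]

theorem twist_psi_zero : twist hβ (psi 0) = psi 1 := by simp [twist_psi]

theorem twist_psi_one : twist hβ (psi 1) = psi 0 := by simp [twist_psi]

theorem twist_psi_of_two_le {b : Fin n} (hb : 2 ≤ b.val) : twist hβ (psi b) = psi b := by
  rw [twist_psi, Equiv.swap_apply_of_ne_of_ne (ne_zero_of_two_le hb) (ne_one_of_two_le hb)]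

theorem twist_y_zero : twist hβ (y 0) = -y 0 := by simp [twist, y, twistGen]

theorem twist_y {j : Fin n} (hj : j ≠ 0) : twist hβ (y j) = y j := by
  simp [twist, y, twistGen, hj]

theorem twist_e (i : β) : twist hβ (e i) = e (flip hβ i) := by simp [twist, e, twistGen]

theorem twist_twist : (twist hβ).comp (twist hβ) = AlgHom.id K (Free β) := by
  apply FreeAlgebra.hom_ext
  funext g
  change twist hβ (twist hβ (FreeAlgebra.ι K g)) = FreeAlgebra.ι K g
  cases g with
  | psi a =>
    change twist hβ (twist hβ (psi a)) = psi a
    rw [twist_psi, twist_psi, Equiv.swap_apply_self]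
  | y j =>
    change twist hβ (twist hβ (y j)) = y j
    by_cases hj : j = 0
    · subst hj
      rw [twist_y_zero, map_neg, twist_y_zero, neg_neg]
    · rw [twist_y hβ hj, twist_y hβ hj]
  | e i =>
    change twist hβ (twist hβ (e i)) = e i
    rw [twist_e, twist_e, flip_flip]

theorem respects_WRel_typeA {F : Free β →ₐ[K] A} (h : Respects (WRel β) F) :
    Respects (ARel β) F := by
  intro a b hab
  apply h
  cases hab with
  | psi_e b i j hb hij => exact .psi_e b i j (by rw [s_of_ne hb, hij])
  | psi_comm a b ha hb hab => exact .psi_comm a b ha hb (by rwa [abs_sub_comm])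
  | _ => constructor <;> assumption

/-- A type A relation involving `ψ_1` at `i` becomes the corresponding relation for `Ψ_0` at
`r_0(i)`, whose inverted first entry is again `i_1`; the sign changes of `y_1` match. Relations with
all indices at least 2 do not see the first entry and twist to type A relations. -/
theorem respects_WRel_twist (hn : 2 ≤ n) {F : Free β →ₐ[K] A} (h : Respects (WRel β) F) :
    Respects (ARel β) (F.comp (twist hβ)) := by
  have h1v := val_one_fin hn
  have h10 := one_ne_zero_fin hn
  have hp := pr_one hn
  have hA := respects_WRel_typeA h
  intro a b hab
  cases hab with
  | sum_e =>
    have := h .sum_e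
    simp only [map_sum] at this
    simp only [AlgHom.comp_apply, map_sum, twist_e]
    rw [sum_flip hβ (fun i => F (e i)), this]
    simp
  | e_mul_self i => simpa [twist_e] using h (.e_mul_self (flip hβ i))
  | e_mul_ne i j hij =>
    simpa [twist_e] using h (.e_mul_ne _ _ ((flip_injective hβ).ne hij))
  | y_comm j k =>
    have := h (.y_comm j k)
    by_cases hj : j = 0 <;> by_cases hk : k = 0 <;>
      simp_all [twist_y, twist_y_zero]
  | y_e j i =>
    have := h (.y_e j (flip hβ i))
    by_cases hj : j = 0 <;> simp_all [twist_y, twist_y_zero, twist_e]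
  | psi_e b i j hb hij =>
    by_cases hb1 : b = 1
    · subst hb1
      have := h (.psi_e 0 (flip hβ i) (flip hβ j) (by
        rw [s_zero hn]
        simp only [flip, r_r, hij]))
      simpa [twist_psi_one, twist_e] using this
    · have hb2 := two_le_val hb hb1
      have := hA (.psi_e b (flip hβ i) (flip hβ j) hb (by
        simp only [flip, hij, r_zero_comm hb2]))
      simpa [twist_psi_of_two_le hβ hb2, twist_e] using this
  | psi_y_left b i hb hi =>
    by_cases hb1 : b = 1
    · subst hb1
      rw [hp] at hi
      have := h (.psi0_y_eq 1 0 (flip hβ i) h1v (.inl rfl) (by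
        rw [flip_zero, flip_apply hβ h10, inv_inv, hi]))
      simp only [hp, AlgHom.comp_apply, map_mul, map_sub, map_neg, twist_psi_one, twist_y_zero,
        twist_y hβ h10, twist_e]
      simp only [map_mul, map_add, map_neg, map_one, Equiv.swap_apply_left, add_mul] at this
      simp only [sub_mul, mul_neg, neg_mul, one_mul] at this ⊢
      rw [this]
      abel
    · have hb2 := two_le_val hb hb1
      have := hA (.psi_y_left b (flip hβ i) hb (by
        rw [flip_apply hβ (pr_ne_zero hb2), flip_apply hβ hb, hi]))
      simpa [twist_psi_of_two_le hβ hb2, twist_e, twist_y hβ hb,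
        twist_y hβ (pr_ne_zero hb2)] using this
  | psi_y_right b i hb hi =>
    by_cases hb1 : b = 1
    · subst hb1
      rw [hp] at hi
      have := h (.psi0_y_eq 1 1 (flip hβ i) h1v (.inr rfl) (by
        rw [flip_zero, flip_apply hβ h10, inv_inv, hi]))
      simp only [hp, AlgHom.comp_apply, map_mul, map_sub, map_neg, twist_psi_one, twist_y_zero,
        twist_y hβ h10, twist_e]
      simp only [map_mul, map_add, map_neg, map_one, Equiv.swap_apply_right, add_mul] at this
      simp only [sub_mul, neg_mul] at this ⊢
      rw [this]
      simp
    · have hb2 := two_le_val hb hb1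
      have := hA (.psi_y_right b (flip hβ i) hb (by
        rw [flip_apply hβ (pr_ne_zero hb2), flip_apply hβ hb, hi]))
      simpa [twist_psi_of_two_le hβ hb2, twist_e, twist_y hβ hb,
        twist_y hβ (pr_ne_zero hb2)] using this
  | psi_y_else b j i hb hi =>
    by_cases hb1 : b = 1
    · subst hb1
      rw [hp] at hi ⊢
      by_cases hj : j = 0 ∨ j = 1
      · have := h (.psi0_y_ne 1 j (flip hβ i) h1v hj (by
          rw [flip_zero, flip_apply hβ h10, inv_inv]
          exact fun h' => hi ⟨hj, h'⟩))
        rcases hj with rfl | rfl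
        · simp only [Equiv.swap_apply_left, AlgHom.comp_apply, map_mul, map_sub, map_neg,
            map_zero, twist_psi_one, twist_y_zero, twist_y hβ h10, twist_e, neg_mul, mul_neg,
            sub_mul] at this ⊢
          rw [this]
          simp
        · simp only [Equiv.swap_apply_right, AlgHom.comp_apply, map_mul, map_sub, map_neg,
            map_zero, twist_psi_one, twist_y_zero, twist_y hβ h10, twist_e, neg_mul, sub_mul] at this ⊢
          rw [this]
          simp
      · rw [not_or] at hj
        have := h (.psi0_y_else j (flip hβ i) (two_le_val hj.1 hj.2))
        rw [Equiv.swap_apply_of_ne_of_ne hj.1 hj.2]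
        simpa [twist_psi_one, twist_e, twist_y hβ hj.1, sub_mul, sub_eq_zero] using this
    · have hb2 := two_le_val hb hb1
      have := hA (.psi_y_else b j (flip hβ i) hb (by
        rwa [flip_apply hβ (pr_ne_zero hb2), flip_apply hβ hb]))
      -- The sign of `y_1` appears on both sides, since the transposition for `b ≥ 2` fixes the
      -- first position and preserves its complement.
      by_cases hj : j = 0
      · subst hj
        rw [Equiv.swap_apply_of_ne_of_ne (pr_ne_zero hb2).symm hb.symm] at this ⊢
        simp only [AlgHom.comp_apply, map_mul, map_sub, map_neg, map_zero,
          twist_psi_of_two_le hβ hb2, twist_y_zero, twist_e, neg_mul, mul_neg, sub_mul,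
          sub_eq_zero] at this ⊢
        rw [this]
      · have hs : Equiv.swap (pr b) b j ≠ 0 := by
          intro h'
          rw [Equiv.swap_apply_eq_iff,
            Equiv.swap_apply_of_ne_of_ne (pr_ne_zero hb2).symm hb.symm] at h'
          exact hj h'
        simpa [twist_psi_of_two_le hβ hb2, twist_e, twist_y hβ hj, twist_y hβ hs] using this
  | psi_comm a b ha hb hab =>
    -- Being far from 1 means being larger than 2, which is the range where `Ψ_0` is required to
    -- commute.
    have hv : ∀ c : Fin n, 1 < |(c.val : ℤ) - 1| → c ≠ 0 → 2 < c.val := by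
      intro c hc hc0
      have : c.val ≠ 0 := fun h' => hc0 (Fin.ext h')
      rcases lt_abs.mp hc with h' | h' <;> omega
    by_cases ha1 : a = 1
    · subst ha1
      rw [h1v, abs_sub_comm] at hab
      have hb2 := hv b (by simpa using hab) hb
      simpa [twist_psi_one, twist_psi_of_two_le hβ hb2.le] using h (.psi0_comm b (.inr hb2))
    · have ha2 := two_le_val ha ha1
      by_cases hb1 : b = 1
      · subst hb1
        rw [h1v] at hab
        have ha3 := hv a (by simpa using hab) ha
        simpa [twist_psi_one, twist_psi_of_two_le hβ ha2] using
          (h (.psi0_comm a (.inr ha3))).symm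
      · have hb2 := two_le_val hb hb1
        simpa [twist_psi_of_two_le hβ hb2, twist_psi_of_two_le hβ ha2] using
          hA (.psi_comm a b ha hb hab)
  | psi_sq_eq b i hb hi =>
    by_cases hb1 : b = 1
    · subst hb1
      rw [hp] at hi
      simpa [twist_psi_one, twist_e] using h (.psi0_sq_eq 1 (flip hβ i) h1v (by
        rwa [flip_zero, flip_apply hβ h10, inv_inv]))
    · have hb2 := two_le_val hb hb1
      simpa [twist_psi_of_two_le hβ hb2, twist_e] using hA (.psi_sq_eq b (flip hβ i) hb (by
        rwa [flip_apply hβ (pr_ne_zero hb2), flip_apply hβ hb]))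
  | psi_sq_none b i hb hi =>
    by_cases hb1 : b = 1
    · subst hb1
      rw [hp] at hi
      simpa [twist_psi_one, twist_e] using h (.psi0_sq_none 1 (flip hβ i) h1v (by
        rwa [flip_zero, flip_apply hβ h10, inv_inv]))
    · have hb2 := two_le_val hb hb1
      simpa [twist_psi_of_two_le hβ hb2, twist_e] using hA (.psi_sq_none b (flip hβ i) hb (by
        rwa [flip_apply hβ (pr_ne_zero hb2), flip_apply hβ hb]))
  | psi_sq_to b i hb hi =>
    by_cases hb1 : b = 1
    · subst hb1
      rw [hp] at hi ⊢
      simpa [twist_psi_one, twist_e, twist_y_zero, twist_y hβ h10, add_comm] using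
        h (.psi0_sq_to 1 (flip hβ i) h1v (by
        rwa [flip_zero, flip_apply hβ h10, inv_inv]))
    · have hb2 := two_le_val hb hb1
      simpa [twist_psi_of_two_le hβ hb2, twist_e, twist_y hβ hb, twist_y hβ (pr_ne_zero hb2)]
        using hA (.psi_sq_to b (flip hβ i) hb (by
        rwa [flip_apply hβ (pr_ne_zero hb2), flip_apply hβ hb]))
  | psi_sq_from b i hb hi =>
    by_cases hb1 : b = 1
    · subst hb1
      rw [hp] at hi ⊢
      simpa [twist_psi_one, twist_e, twist_y_zero, twist_y hβ h10, neg_add, sub_eq_add_neg,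
        add_comm, neg_mul, add_mul] using
        h (.psi0_sq_from 1 (flip hβ i) h1v (by
        rwa [flip_zero, flip_apply hβ h10, inv_inv]))
    · have hb2 := two_le_val hb hb1
      simpa [twist_psi_of_two_le hβ hb2, twist_e, twist_y hβ hb, twist_y hβ (pr_ne_zero hb2)]
        using hA (.psi_sq_from b (flip hβ i) hb (by
        rwa [flip_apply hβ (pr_ne_zero hb2), flip_apply hβ hb]))
  | psi_sq_both b i hb hi =>
    by_cases hb1 : b = 1
    · subst hb1
      rw [hp] at hi ⊢
      have := h (.psi0_sq_both 1 (flip hβ i) h1v (by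
        rwa [flip_zero, flip_apply hβ h10, inv_inv]))
      simp only [AlgHom.comp_apply, map_mul, map_sub, map_neg, map_pow, map_add, twist_psi_one,
        twist_y_zero, twist_y hβ h10, twist_e] at this ⊢
      rw [this]
      congr 1
      noncomm_ring
    · have hb2 := two_le_val hb hb1
      simpa [twist_psi_of_two_le hβ hb2, twist_e, twist_y hβ hb, twist_y hβ (pr_ne_zero hb2)]
        using hA (.psi_sq_both b (flip hβ i) hb (by
        rwa [flip_apply hβ (pr_ne_zero hb2), flip_apply hβ hb]))
  | braid_to b c i hb hc hi hi' =>
    -- Only the smaller index of a braid pair can be 1, so `ψ_c` is fixed by the twist.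
    have hc2 : 2 ≤ c.val := two_le_val (by rintro rfl; simp at hc) (by
      rintro rfl; rw [h1v] at hc; exact hb (Fin.ext (by simpa using hc.symm)))
    have hc0 := ne_zero_of_two_le hc2
    by_cases hb1 : b = 1
    · subst hb1
      rw [hp] at hi
      simpa [twist_psi_one, twist_psi_of_two_le hβ hc2, twist_e] using
        h (.braid0_to 1 c (flip hβ i) h1v (by rw [hc, h1v])
          (by rwa [flip_zero, flip_apply hβ hc0, inv_inv])
          (by rwa [flip_apply hβ hc0, flip_apply hβ h10]))
    · have hb2 := two_le_val hb hb1
      simpa [twist_psi_of_two_le hβ hb2, twist_psi_of_two_le hβ hc2, twist_e] using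
        hA (.braid_to b c (flip hβ i) hb hc
          (by rwa [flip_apply hβ (pr_ne_zero hb2), flip_apply hβ hc0])
          (by rwa [flip_apply hβ hc0, flip_apply hβ hb]))
  | braid_from b c i hb hc hi hi' =>
    have hc2 : 2 ≤ c.val := two_le_val (by rintro rfl; simp at hc) (by
      rintro rfl; rw [h1v] at hc; exact hb (Fin.ext (by simpa using hc.symm)))
    have hc0 := ne_zero_of_two_le hc2
    by_cases hb1 : b = 1
    · subst hb1
      rw [hp] at hi
      simpa [twist_psi_one, twist_psi_of_two_le hβ hc2, twist_e] using
        h (.braid0_from 1 c (flip hβ i) h1v (by rw [hc, h1v])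
          (by rwa [flip_zero, flip_apply hβ hc0, inv_inv])
          (by rwa [flip_apply hβ hc0, flip_apply hβ h10]))
    · have hb2 := two_le_val hb hb1
      simpa [twist_psi_of_two_le hβ hb2, twist_psi_of_two_le hβ hc2, twist_e] using
        hA (.braid_from b c (flip hβ i) hb hc
          (by rwa [flip_apply hβ (pr_ne_zero hb2), flip_apply hβ hc0])
          (by rwa [flip_apply hβ hc0, flip_apply hβ hb]))
  | braid_both b c i hb hc hi hi' =>
    have hc2 : 2 ≤ c.val := two_le_val (by rintro rfl; simp at hc) (by
      rintro rfl; rw [h1v] at hc; exact hb (Fin.ext (by simpa using hc.symm)))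
    have hc0 := ne_zero_of_two_le hc2
    by_cases hb1 : b = 1
    · subst hb1
      rw [hp] at hi ⊢
      simpa [two_mul, twist_psi_one, twist_psi_of_two_le hβ hc2, twist_e, twist_y hβ hc0,
        twist_y hβ h10, twist_y_zero, sub_eq_add_neg] using
        h (.braid0_both 1 c (flip hβ i) h1v (by rw [hc, h1v])
          (by rwa [flip_zero, flip_apply hβ hc0, inv_inv])
          (by rwa [flip_apply hβ hc0, flip_apply hβ h10]))
    · have hb2 := two_le_val hb hb1
      simpa [two_mul, twist_psi_of_two_le hβ hb2, twist_psi_of_two_le hβ hc2, twist_e,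
        twist_y hβ hc0, twist_y hβ hb, twist_y hβ (pr_ne_zero hb2)] using
        hA (.braid_both b c (flip hβ i) hb hc
          (by rwa [flip_apply hβ (pr_ne_zero hb2), flip_apply hβ hc0])
          (by rwa [flip_apply hβ hc0, flip_apply hβ hb]))
  | braid_else b c i hb hc hi =>
    have hc2 : 2 ≤ c.val := two_le_val (by rintro rfl; simp at hc) (by
      rintro rfl; rw [h1v] at hc; exact hb (Fin.ext (by simpa using hc.symm)))
    have hc0 := ne_zero_of_two_le hc2
    by_cases hb1 : b = 1
    · subst hb1
      rw [hp] at hi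
      simpa [twist_psi_one, twist_psi_of_two_le hβ hc2, twist_e] using
        h (.braid0_else 1 c (flip hβ i) h1v (by rw [hc, h1v])
          (by rwa [flip_zero, flip_apply hβ hc0, inv_inv, flip_apply hβ h10]))
    · have hb2 := two_le_val hb hb1
      simpa [twist_psi_of_two_le hβ hb2, twist_psi_of_two_le hβ hc2, twist_e] using
        hA (.braid_else b c (flip hβ i) hb hc
          (by rwa [flip_apply hβ (pr_ne_zero hb2), flip_apply hβ hc0, flip_apply hβ hb]))

/-- The relations of `W` are the type `A` relations, their twists, and `Ψ_0 Ψ_1 = Ψ_1 Ψ_0`. -/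
theorem respects_WRel_of_typeA (hn : 2 ≤ n) {F : Free β →ₐ[K] A} (hA : Respects (ARel β) F)
    (hT : Respects (ARel β) (F.comp (twist hβ)))
    (hcomm : F (psi 0) * F (psi 1) = F (psi 1) * F (psi 0)) : Respects (WRel β) F := by
  have h1v := val_one_fin hn
  have h10 := one_ne_zero_fin hn
  have hp := pr_one hn
  intro a b hab
  cases hab with
  | psi_e a i j hij =>
    by_cases ha : a = 0
    · subst ha
      -- Starting from the flipped tuples, the flip inside the twist returns `i` and `j`. The same
      -- device is used for the other `Ψ_0` relations.
      have := hT (.psi_e 1 (flip hβ i) (flip hβ j) h10 (by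
        rw [s_zero hn] at hij
        simp only [flip, hij, r_r]))
      simpa [twist_psi_one, twist_e, flip_flip] using this
    · exact hA (.psi_e a i j ha (by rw [hij, s_of_ne ha]))
  | psi_comm a b ha hb hab => exact hA (.psi_comm a b ha hb (by rwa [abs_sub_comm]))
  | psi0_comm b hb =>
    rcases hb with hb | hb
    -- The one relation that is neither of type A nor the twist of such a relation.
    · obtain rfl := eq_one_of_val hb
      simpa using hcomm
    · have := hT (.psi_comm 1 b h10 (ne_zero_of_two_le hb.le) (by
        rw [h1v, abs_sub_comm]
        exact lt_abs.mpr (.inl (by push_cast; omega))))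
      simpa [twist_psi_one, twist_psi_of_two_le hβ hb.le] using this
  | psi0_y_eq t j i ht hj hi =>
    obtain rfl := eq_one_of_val ht
    have hi' : (flip hβ i).1 0 = (flip hβ i).1 1 := by rwa [flip_zero, flip_apply hβ h10]
    rcases hj with rfl | rfl
    · have := hT (.psi_y_left 1 (flip hβ i) h10 (by rwa [hp]))
      simp only [hp, AlgHom.comp_apply, map_mul, map_sub, map_neg, twist_psi_one, twist_y_zero,
        twist_y hβ h10, twist_e, flip_flip, sub_mul, mul_neg, neg_mul] at this
      simp only [map_mul, map_add, map_neg, Equiv.swap_apply_left, add_mul, one_mul, neg_mul]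
      rw [sub_eq_iff_eq_add, neg_eq_iff_eq_neg] at this
      rw [this]
      abel
    · have := hT (.psi_y_right 1 (flip hβ i) h10 (by rwa [hp]))
      simp only [hp, AlgHom.comp_apply, map_mul, map_sub, map_neg, twist_psi_one, twist_y_zero,
        twist_y hβ h10, twist_e, flip_flip, sub_mul, neg_mul] at this
      simp only [map_mul, map_add, map_neg, Equiv.swap_apply_right, add_mul, one_mul, neg_mul]
      rw [sub_eq_iff_eq_add] at this
      rw [this]
      abel
  | psi0_y_ne t j i ht hj hi =>
    obtain rfl := eq_one_of_val ht
    have := hT (.psi_y_else 1 j (flip hβ i) h10 (by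
      rw [hp, flip_zero, flip_apply hβ h10]
      exact fun h' => hi h'.2))
    rcases hj with rfl | rfl
    · simp only [hp, AlgHom.comp_apply, map_mul, map_sub, map_zero, map_neg, twist_psi_one,
        twist_y_zero, twist_y hβ h10, twist_e, flip_flip, sub_mul, mul_neg, neg_mul,
        Equiv.swap_apply_left] at this ⊢
      rw [sub_eq_zero, neg_eq_iff_eq_neg] at this
      exact this
    · simp only [hp, AlgHom.comp_apply, map_mul, map_sub, map_zero, map_neg, twist_psi_one,
        twist_y_zero, twist_y hβ h10, twist_e, flip_flip, sub_mul, neg_mul,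
        Equiv.swap_apply_right] at this ⊢
      rwa [sub_eq_zero] at this
  | psi0_y_else j i hj =>
    have hj0 := ne_zero_of_two_le hj
    have hj1 := ne_one_of_two_le hj
    have := hT (.psi_y_else 1 j (flip hβ i) h10 (by
      rw [hp]
      exact fun h' => h'.1.elim hj0 hj1))
    rw [hp, Equiv.swap_apply_of_ne_of_ne hj0 hj1] at this
    simpa [twist_psi_one, twist_e, flip_flip, twist_y hβ hj0, sub_mul, sub_eq_zero] using this
  | psi0_sq_eq t i ht hi =>
    obtain rfl := eq_one_of_val ht
    simpa [twist_psi_one, twist_e, flip_flip] using hT (.psi_sq_eq 1 (flip hβ i) h10 (by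
      rwa [hp, flip_zero, flip_apply hβ h10]))
  | psi0_sq_none t i ht hi =>
    obtain rfl := eq_one_of_val ht
    simpa [twist_psi_one, twist_e, flip_flip] using hT (.psi_sq_none 1 (flip hβ i) h10 (by
      rwa [hp, flip_zero, flip_apply hβ h10]))
  | psi0_sq_to t i ht hi =>
    obtain rfl := eq_one_of_val ht
    simpa [hp, twist_psi_one, twist_e, flip_flip, twist_y_zero, twist_y hβ h10, add_comm] using
      hT (.psi_sq_to 1 (flip hβ i) h10 (by rwa [hp, flip_zero, flip_apply hβ h10]))
  | psi0_sq_from t i ht hi =>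
    obtain rfl := eq_one_of_val ht
    simpa [hp, twist_psi_one, twist_e, flip_flip, twist_y_zero, twist_y hβ h10, neg_add,
        sub_eq_add_neg, add_comm, neg_mul, add_mul] using
      hT (.psi_sq_from 1 (flip hβ i) h10 (by rwa [hp, flip_zero, flip_apply hβ h10]))
  | psi0_sq_both t i ht hi =>
    obtain rfl := eq_one_of_val ht
    have := hT (.psi_sq_both 1 (flip hβ i) h10 (by rwa [hp, flip_zero, flip_apply hβ h10]))
    simp only [hp, AlgHom.comp_apply, map_mul, map_sub, map_neg, map_pow, map_add, twist_psi_one,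
      twist_y_zero, twist_y hβ h10, twist_e, flip_flip] at this ⊢
    rw [this]
    congr 1
    noncomm_ring
  | braid0_to t u i ht hu hi hi' =>
    obtain rfl := eq_one_of_val ht
    have hu0 := ne_zero_of_two_le hu.ge
    simpa [twist_psi_one, twist_psi_of_two_le hβ hu.ge, twist_e, flip_flip] using
      hT (.braid_to 1 u (flip hβ i) h10 (by rw [hu, h1v])
        (by rwa [hp, flip_zero, flip_apply hβ hu0])
        (by rwa [flip_apply hβ hu0, flip_apply hβ h10]))
  | braid0_from t u i ht hu hi hi' =>
    obtain rfl := eq_one_of_val ht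
    have hu0 := ne_zero_of_two_le hu.ge
    simpa [twist_psi_one, twist_psi_of_two_le hβ hu.ge, twist_e, flip_flip] using
      hT (.braid_from 1 u (flip hβ i) h10 (by rw [hu, h1v])
        (by rwa [hp, flip_zero, flip_apply hβ hu0])
        (by rwa [flip_apply hβ hu0, flip_apply hβ h10]))
  | braid0_both t u i ht hu hi hi' =>
    obtain rfl := eq_one_of_val ht
    have hu0 := ne_zero_of_two_le hu.ge
    simpa [two_mul, hp, twist_psi_one, twist_psi_of_two_le hβ hu.ge, twist_e, flip_flip,
        twist_y hβ hu0, twist_y hβ h10, twist_y_zero, sub_eq_add_neg] using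
      hT (.braid_both 1 u (flip hβ i) h10 (by rw [hu, h1v])
        (by rwa [hp, flip_zero, flip_apply hβ hu0])
        (by rwa [flip_apply hβ hu0, flip_apply hβ h10]))
  | braid0_else t u i ht hu hi =>
    obtain rfl := eq_one_of_val ht
    have hu0 := ne_zero_of_two_le hu.ge
    simpa [twist_psi_one, twist_psi_of_two_le hβ hu.ge, twist_e, flip_flip] using
      hT (.braid_else 1 u (flip hβ i) h10 (by rw [hu, h1v])
        (by rwa [hp, flip_zero, flip_apply hβ hu0, flip_apply hβ h10]))
  | _ => apply hA; constructor <;> assumption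

end Twist

/-! ### Universal properties of the cyclotomic quotients, and the involution `σ` -/

section Cyclotomic

variable {K : Type*} [Field K] {q : Kˣ} {l : ℕ} {lam : Fin l → Kˣ} {n : ℕ}
  (m : Vertex q lam →₀ ℕ) {β : Finset (Fin n → Vertex q lam)} {A : Type*} [Ring A] [Algebra K A]

theorem Free.hom_ext {F G : Free β →ₐ[K] A} (hpsi : ∀ a, F (psi a) = G (psi a))
    (hy : ∀ j, F (y j) = G (y j)) (he : ∀ i, F (e i) = G (e i)) : F = G := by
  apply FreeAlgebra.hom_ext
  funext g
  cases g with
  | psi a => exact hpsi a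
  | y j => exact hy j
  | e i => exact he i

variable [NeZero n]

variable (β) in
/-- The quotient map from the free algebra to `V_{λ,m}^β`. -/
noncomputable def projV : Free β →ₐ[K] VCyc m β := (toVCyc m β).comp (toV β)

variable (β) in
/-- The quotient map from `W_λ^β` to `W_{λ,m}^β`. -/
noncomputable def toWCyc : WAlg β →ₐ[K] WCyc m β := RingQuot.mkAlgHom K (WCycRel m β)

variable (β) in
/-- The quotient map from the free algebra to `W_{λ,m}^β`. -/
noncomputable def projW : Free β →ₐ[K] WCyc m β := (toWCyc m β).comp (toW β)

theorem projV_respects : Respects (VRel β) (projV m β) := fun _ _ h =>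
  congrArg (toVCyc m β) (toV_rel h)

theorem projW_respects : Respects (WRel β) (projW m β) := fun _ _ h =>
  congrArg (toWCyc m β) (RingQuot.mkAlgHom_rel K h)

theorem projV_cyc (i : β) : projV m β (y 0) ^ m (i.1 0) * projV m β (e i) = 0 := by
  have h : toVCyc m β _ = toVCyc m β _ := RingQuot.mkAlgHom_rel K (VCycRel.cyc (m := m) i)
  simpa [projV] using h

theorem projW_cyc (i : β) : projW m β (y 0) ^ m (i.1 0) * projW m β (e i) = 0 := by
  have h : toWCyc m β _ = toWCyc m β _ := RingQuot.mkAlgHom_rel K (WCycRel.cyc (m := m) i)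
  simpa [projW] using h

theorem projV_surjective : Function.Surjective (projV m β) :=
  (RingQuot.mkAlgHom_surjective K (VCycRel m β)).comp (RingQuot.mkAlgHom_surjective K (VRel β))

theorem projW_surjective : Function.Surjective (projW m β) :=
  (RingQuot.mkAlgHom_surjective K (WCycRel m β)).comp (RingQuot.mkAlgHom_surjective K (WRel β))

theorem exists_lift_VCyc {F : Free β →ₐ[K] A} (h : Respects (VRel β) F)
    (hc : ∀ i : β, F (y 0) ^ m (i.1 0) * F (e i) = 0) :
    ∃ f : VCyc m β →ₐ[K] A, f.comp (projV m β) = F := by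
  let g : VAlg β →ₐ[K] A := RingQuot.liftAlgHom K ⟨F, h⟩
  have hg : ∀ x, g (toV β x) = F x := RingQuot.liftAlgHom_mkAlgHom_apply K F h
  have hr : ∀ ⦃a b⦄, VCycRel m β a b → g a = g b := by
    rintro _ _ ⟨i⟩
    rw [map_mul, map_pow, hg, hg, hc, map_zero]
  refine ⟨RingQuot.liftAlgHom K ⟨g, hr⟩, AlgHom.ext fun x => ?_⟩
  exact (RingQuot.liftAlgHom_mkAlgHom_apply K g hr (toV β x)).trans (hg x)

theorem exists_lift_WCyc {F : Free β →ₐ[K] A} (h : Respects (WRel β) F)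
    (hc : ∀ i : β, F (y 0) ^ m (i.1 0) * F (e i) = 0) :
    ∃ f : WCyc m β →ₐ[K] A, f.comp (projW m β) = F := by
  let g : WAlg β →ₐ[K] A := RingQuot.liftAlgHom K ⟨F, h⟩
  have hg : ∀ x, g (toW β x) = F x := RingQuot.liftAlgHom_mkAlgHom_apply K F h
  have hr : ∀ ⦃a b⦄, WCycRel m β a b → g a = g b := by
    rintro _ _ ⟨i⟩
    rw [map_mul, map_pow, hg, hg, hc, map_zero]
  refine ⟨RingQuot.liftAlgHom K ⟨g, hr⟩, AlgHom.ext fun x => ?_⟩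
  exact (RingQuot.liftAlgHom_mkAlgHom_apply K g hr (toW β x)).trans (hg x)

/-- The diagram involution of `W_{λ,m}^β`. -/
theorem exists_involution_WCyc {m : Vertex q lam →₀ ℕ} (hm : ∀ i, m i⁻¹ = m i)
    (hβ : ∀ i ∈ β, r 0 i ∈ β) (hn : 2 ≤ n) :
    ∃ σ : WCyc m β →ₐ[K] WCyc m β, σ.comp (projW m β) = (projW m β).comp (twist hβ) ∧
      ∀ w, σ (σ w) = w := by
  have hW := projW_respects m (β := β)
  -- Since the twist squares to the identity, composing with it only interchanges the two type A
  -- conditions in the criterion for `W` and reverses the commutation.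
  obtain ⟨σ, hσ⟩ := exists_lift_WCyc m (F := (projW m β).comp (twist hβ))
    (respects_WRel_of_typeA hβ hn (respects_WRel_twist hβ hn hW)
      (by
        rw [AlgHom.comp_assoc, twist_twist, AlgHom.comp_id]
        exact respects_WRel_typeA hW)
      (by
        simpa [twist_psi_zero, twist_psi_one] using
          (hW (.psi0_comm 1 (.inl (val_one_fin hn)))).symm))
    (fun i => by
      have := projW_cyc m (flip hβ i)
      -- The flipped tuple begins with the inverse of `i_1`, so its cyclotomic exponent is the right
      -- one by symmetry of `m`; the sign from `-y_1` only contributes a factor `(-1)^m`.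
      rw [flip_zero, hm] at this
      rw [AlgHom.comp_apply, AlgHom.comp_apply, twist_y_zero, twist_e, map_neg, neg_pow, mul_assoc,
        this, mul_zero])
  refine ⟨σ, hσ, fun w => ?_⟩
  obtain ⟨x, rfl⟩ := projW_surjective m w
  have h : ∀ x, σ (projW m β x) = projW m β (twist hβ x) := DFunLike.congr_fun hσ
  rw [h, h]
  exact congrArg (projW m β) (DFunLike.congr_fun (twist_twist hβ) x)

end Cyclotomic

/-! ### The crossed product with an involution, as 2 × 2 matrices -/

section CrossedProduct

variable {K W : Type*} [Field K] [Ring W] [Algebra K W] (σ : W →ₐ[K] W)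

/-- The embedding `w ↦ diag(w, σ(w))`, the restriction to `W` of the action of the crossed product
of `W` with `{1, σ}`. -/
noncomputable def twistedDiag : W →ₐ[K] Matrix (Fin 2) (Fin 2) W :=
  (Matrix.diagonalAlgHom K).comp
    (AlgHom.pi (fun k : Fin 2 => if k = 0 then AlgHom.id K W else σ))

/-- The element of the crossed product that induces `σ`. -/
def swapMatrix (W : Type*) [Ring W] : Matrix (Fin 2) (Fin 2) W := !![0, 1; 1, 0]

theorem twistedDiag_apply (w : W) : twistedDiag σ w = !![w, 0; 0, σ w] := by
  ext a b
  fin_cases a <;> fin_cases b <;> simp [twistedDiag]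

theorem twistedDiag_injective : Function.Injective (twistedDiag σ) := by
  intro v w h
  rw [twistedDiag_apply, twistedDiag_apply] at h
  simpa using congrFun (congrFun h 0) 0

theorem swapMatrix_mul_self : swapMatrix W * swapMatrix W = 1 := by
  simp [swapMatrix, Matrix.one_fin_two]

/-- Conjugation by the swap takes `diag(w, σ w)` to `diag(σ w, w)`, which is the matrix of `σ w`
because `σ` is an involution. -/
theorem swapMatrix_mul_twistedDiag (hσ : ∀ w, σ (σ w) = w) (w : W) :
    swapMatrix W * twistedDiag σ w = twistedDiag σ (σ w) * swapMatrix W := by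
  simp [swapMatrix, twistedDiag_apply, hσ]

end CrossedProduct

/-! ### The homomorphism from `W` to `V` and its left inverse up to matrices -/

section Main

variable {K : Type*} [Field K] {q : Kˣ} {l : ℕ} {lam : Fin l → Kˣ} {n : ℕ} [NeZero n]
  {m : Vertex q lam →₀ ℕ} {β : Finset (Fin n → Vertex q lam)}

variable (m β) in
/-- The homomorphism `Ψ_0 ↦ ψ_0 ψ_1 ψ_0` from the free algebra to `V_{λ,m}^β` that fixes the names
of all other generators. -/
noncomputable def embedFree : Free β →ₐ[K] VCyc m β :=
  FreeAlgebra.lift K fun g => match g with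
    | Gen.psi a => if a = 0 then projV m β (psi 0) * projV m β (psi 1) * projV m β (psi 0)
        else projV m β (psi a)
    | Gen.y j => projV m β (y j)
    | Gen.e i => projV m β (e i)

theorem embedFree_psi_zero :
    embedFree m β (psi 0) = projV m β (psi 0) * projV m β (psi 1) * projV m β (psi 0) := by
  simp [embedFree, psi]

theorem embedFree_psi {a : Fin n} (ha : a ≠ 0) : embedFree m β (psi a) = projV m β (psi a) := by
  simp [embedFree, psi, ha]

theorem embedFree_y (j : Fin n) : embedFree m β (y j) = projV m β (y j) := by
  simp [embedFree, y]

theorem embedFree_e (i : β) : embedFree m β (e i) = projV m β (e i) := by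
  simp [embedFree, e]

theorem embedFree_typeA : Respects (ARel β) (embedFree m β) :=
  (respects_VRel_iff.mp (projV_respects m)).1.congr_typeA (fun _ => embedFree_psi) embedFree_y
    embedFree_e

/-- The twist is conjugation by `ψ_0`. -/
theorem psi_zero_mul_embedFree (hβ : ∀ i ∈ β, r 0 i ∈ β) (hn : 2 ≤ n) (x : Free β) :
    projV m β (psi 0) * embedFree m β x = embedFree m β (twist hβ x) * projV m β (psi 0) := by
  have h10 := one_ne_zero_fin hn
  obtain ⟨-, he, hcomm, hy0, hy, hsq, -⟩ := respects_VRel_iff.mp (projV_respects m (β := β))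
  induction x using FreeAlgebra.induction with
  | grade0 c =>
    rw [AlgHom.commutes, AlgHom.commutes, AlgHom.commutes]
    exact (Algebra.commutes c _).symm
  | grade1 g =>
    cases g with
    | psi a =>
      change _ * embedFree m β (psi a) = embedFree m β (twist hβ (psi a)) * _
      by_cases h0 : a = 0
      · subst h0
        rw [twist_psi_zero, embedFree_psi_zero, embedFree_psi h10, ← mul_assoc, ← mul_assoc, hsq,
          one_mul]
      by_cases h1 : a = 1
      · subst h1
        rw [twist_psi_one, embedFree_psi_zero, embedFree_psi h10, mul_assoc _ _ (projV m β (psi 0)),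
          hsq, mul_one]
      · have h2 := two_le_val h0 h1
        rw [twist_psi_of_two_le hβ h2, embedFree_psi h0, hcomm a h2]
    | y j =>
      change _ * embedFree m β (y j) = embedFree m β (twist hβ (y j)) * _
      by_cases h0 : j = 0
      · subst h0
        rw [twist_y_zero, map_neg, embedFree_y, neg_mul, eq_neg_iff_add_eq_zero, hy0]
      · rw [twist_y hβ h0, embedFree_y, hy j h0]
    | e i =>
      change _ * embedFree m β (e i) = embedFree m β (twist hβ (e i)) * _
      rw [twist_e, embedFree_e, embedFree_e, he i (flip hβ i) rfl]
  | mul a b ha hb =>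
    rw [map_mul, map_mul, map_mul, ← mul_assoc, ha, mul_assoc, hb, mul_assoc]
  | add a b ha hb => rw [map_add, map_add, map_add, mul_add, add_mul, ha, hb]

theorem embedFree_twist (hβ : ∀ i ∈ β, r 0 i ∈ β) (hn : 2 ≤ n) (x : Free β) :
    embedFree m β (twist hβ x) = projV m β (psi 0) * embedFree m β x * projV m β (psi 0) := by
  obtain ⟨-, -, -, -, -, hsq, -⟩ := respects_VRel_iff.mp (projV_respects m (β := β))
  rw [psi_zero_mul_embedFree hβ hn, mul_assoc, hsq, mul_one]

/-- The twisted type A relations are conjugates by `ψ_0` of the type A relations of `V`, and `Ψ_0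
Ψ_1 = Ψ_1 Ψ_0` is the braid relation `(ψ_0 ψ_1)² = (ψ_1 ψ_0)²`. -/
theorem embedFree_respects (hβ : ∀ i ∈ β, r 0 i ∈ β) (hn : 2 ≤ n) :
    Respects (WRel β) (embedFree m β) := by
  have h10 := one_ne_zero_fin hn
  refine respects_WRel_of_typeA hβ hn embedFree_typeA (fun a b hab => ?_) ?_
  · rw [AlgHom.comp_apply, AlgHom.comp_apply, embedFree_twist hβ hn, embedFree_twist hβ hn,
      embedFree_typeA hab]
  · obtain ⟨-, -, -, -, -, -, hbr⟩ := respects_VRel_iff.mp (projV_respects m (β := β))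
    rw [embedFree_psi_zero, embedFree_psi h10, hbr 1 (val_one_fin hn)]

theorem exists_embedding (hβ : ∀ i ∈ β, r 0 i ∈ β) (hn : 2 ≤ n) :
    ∃ θ : WCyc m β →ₐ[K] VCyc m β, θ.comp (projW m β) = embedFree m β :=
  exists_lift_WCyc m (embedFree_respects hβ hn) fun i => by
    rw [embedFree_y, embedFree_e, projV_cyc]

/-- The representation of `V_{λ,m}^β` in the crossed product of `W_{λ,m}^β` with its diagram
involution. -/
theorem exists_hom_crossedProduct (hβ : ∀ i ∈ β, r 0 i ∈ β) (hn : 2 ≤ n)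
    {σ : WCyc m β →ₐ[K] WCyc m β} (hσ : σ.comp (projW m β) = (projW m β).comp (twist hβ))
    (hσσ : ∀ w, σ (σ w) = w) :
    ∃ f : VCyc m β →ₐ[K] Matrix (Fin 2) (Fin 2) (WCyc m β),
      f.comp (embedFree m β) = (twistedDiag σ).comp (projW m β) := by
  have h10 := one_ne_zero_fin hn
  have hσ' : ∀ x, σ (projW m β x) = projW m β (twist hβ x) := DFunLike.congr_fun hσ
  let J := swapMatrix (WCyc m β)
  have hJ : J * J = 1 := swapMatrix_mul_self
  let D : Free β →ₐ[K] Matrix (Fin 2) (Fin 2) (WCyc m β) := (twistedDiag σ).comp (projW m β)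
  have hJD : ∀ x, J * D x = D (twist hβ x) * J := fun x => by
    simp only [D, J, AlgHom.comp_apply]
    rw [swapMatrix_mul_twistedDiag σ hσσ, hσ']
  have hWD : Respects (WRel β) D := (projW_respects m).comp _
  let F : Free β →ₐ[K] Matrix (Fin 2) (Fin 2) (WCyc m β) :=
    FreeAlgebra.lift K fun g => match g with
      | Gen.psi a => if a = 0 then J else D (psi a)
      | Gen.y j => D (y j)
      | Gen.e i => D (e i)
  have F0 : F (psi 0) = J := by simp [F, psi]
  have Fpsi : ∀ a : Fin n, a ≠ 0 → F (psi a) = D (psi a) := fun a ha => by simp [F, psi, ha]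
  have Fy : ∀ j, F (y j) = D (y j) := fun j => by simp [F, y]
  have Fe : ∀ i, F (e i) = D (e i) := fun i => by simp [F, e]
  -- This makes the images of `ψ_0 ψ_1 ψ_0` and `Ψ_0` agree, and reduces the braid relation to the
  -- commutation of `Ψ_0` with `Ψ_1`.
  have hJ1 : J * D (psi 1) * J = D (psi 0) := by
    rw [hJD, twist_psi_one, mul_assoc, hJ, mul_one]
  have hF : Respects (VRel β) F := by
    rw [respects_VRel_iff]
    refine ⟨(respects_WRel_typeA hWD).congr_typeA Fpsi Fy Fe, fun i j hij => ?_, fun b hb => ?_,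
      ?_, fun j hj => ?_, by rw [F0, hJ], fun b hb => ?_⟩
    · obtain rfl : j = flip hβ i := Subtype.ext hij
      rw [F0, Fe, Fe, hJD, twist_e]
    · rw [F0, Fpsi b (ne_zero_of_two_le hb), hJD, twist_psi_of_two_le hβ hb]
    · rw [F0, Fy, hJD, twist_y_zero, map_neg, neg_mul, neg_add_cancel]
    · rw [F0, Fy, hJD, twist_y hβ hj]
    · obtain rfl := eq_one_of_val hb
      rw [F0, Fpsi 1 h10, hJ1]
      simpa using hWD (.psi0_comm 1 (.inl (val_one_fin hn)))
  obtain ⟨f, hf⟩ := exists_lift_VCyc m hF fun i => by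
    rw [Fy, Fe, ← map_pow, ← map_mul, AlgHom.comp_apply, map_mul, map_pow, projW_cyc, map_zero]
  have hf' : ∀ x, f (projV m β x) = F x := DFunLike.congr_fun hf
  refine ⟨f, Free.hom_ext (fun a => ?_) (fun j => ?_) (fun i => ?_)⟩
  · change f (embedFree m β (psi a)) = D (psi a)
    by_cases ha : a = 0
    · subst ha
      rw [embedFree_psi_zero, map_mul, map_mul, hf', hf', F0, Fpsi 1 h10, hJ1]
    · rw [embedFree_psi ha, hf', Fpsi a ha]
  · change f (embedFree m β (y j)) = D (y j)
    rw [embedFree_y, hf', Fy]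
  · change f (embedFree m β (e i)) = D (e i)
    rw [embedFree_e, hf', Fe]

/-! ### The image is the fixed-point subalgebra -/

theorem rhoTilde_projV (x : Free β) :
    rhoTilde m β (projV m β x) = toVCyc m β (rhoFree β x) :=
  (rhoTildeHom_toVCyc m β (toV β x)).trans (congrArg (toVCyc m β) (rhoHom_toV β x))

theorem rhoTilde_psi_zero : rhoTilde m β (projV m β (psi 0)) = -projV m β (psi 0) := by
  rw [rhoTilde_projV, rhoFree_psi_zero, map_neg]
  rfl

/-- The two signs in `ψ_0 ψ_1 ψ_0` cancel; no other generator of the image involves `ψ_0`. -/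
theorem rhoTilde_embedFree (hn : 2 ≤ n) (x : Free β) :
    rhoTilde m β (embedFree m β x) = embedFree m β x := by
  have hpsi : ∀ a : Fin n, a ≠ 0 → rhoTilde m β (projV m β (psi a)) = projV m β (psi a) :=
    fun a ha => by
      rw [rhoTilde_projV, rhoFree_psi ha]
      rfl
  suffices h : (rhoTilde m β).toAlgHom.comp (embedFree m β) = embedFree m β from
    DFunLike.congr_fun h x
  refine Free.hom_ext (fun a => ?_) (fun j => ?_) (fun i => ?_)
  · change rhoTilde m β (embedFree m β (psi a)) = _
    by_cases ha : a = 0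
    · subst ha
      rw [embedFree_psi_zero, map_mul, map_mul, rhoTilde_psi_zero, hpsi 1 (one_ne_zero_fin hn)]
      simp only [neg_mul, mul_neg, neg_neg]
    · rw [embedFree_psi ha, hpsi a ha]
  · change rhoTilde m β (embedFree m β (y j)) = _
    rw [embedFree_y, rhoTilde_projV, rhoFree_y]
    rfl
  · change rhoTilde m β (embedFree m β (e i)) = _
    rw [embedFree_e, rhoTilde_projV, rhoFree_e]
    rfl

/-- With `A` the image of `embedFree`, the sum `A + A ψ_0` contains the generators and is closed
under products, as `ψ_0` passes through `A` at the cost of a twist and squares to 1. -/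
theorem exists_decomposition (hβ : ∀ i ∈ β, r 0 i ∈ β) (hn : 2 ≤ n) (x : Free β) :
    ∃ a b : Free β, projV m β x = embedFree m β a + embedFree m β b * projV m β (psi 0) := by
  obtain ⟨-, -, -, -, -, hsq, -⟩ := respects_VRel_iff.mp (projV_respects m (β := β))
  have hc := psi_zero_mul_embedFree (m := m) hβ hn
  induction x using FreeAlgebra.induction with
  | grade0 c => exact ⟨algebraMap K _ c, 0, by simp⟩
  | grade1 g =>
    cases g with
    | psi a =>
      by_cases ha : a = 0
      · subst ha
        exact ⟨0, 1, by rw [map_zero, map_one, zero_add, one_mul]; rfl⟩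
      · exact ⟨psi a, 0, by rw [embedFree_psi ha, map_zero, zero_mul, add_zero]; rfl⟩
    | y j => exact ⟨y j, 0, by rw [embedFree_y, map_zero, zero_mul, add_zero]; rfl⟩
    | e i => exact ⟨e i, 0, by rw [embedFree_e, map_zero, zero_mul, add_zero]; rfl⟩
  | mul x x' hx hx' =>
    obtain ⟨a, b, h⟩ := hx
    obtain ⟨a', b', h'⟩ := hx'
    -- Multiplication rule of the crossed product, from expanding `(a + b ψ_0)(a' + b' ψ_0)`.
    refine ⟨a * a' + b * twist hβ b', a * b' + b * twist hβ a', ?_⟩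
    rw [map_mul, h, h']
    simp only [map_mul, map_add, add_mul, mul_add]
    have h1 : embedFree m β b * projV m β (psi 0) * (embedFree m β b' * projV m β (psi 0)) =
        embedFree m β b * embedFree m β (twist hβ b') := by
      rw [mul_assoc, ← mul_assoc (projV m β (psi 0)), hc, mul_assoc, hsq, mul_one]
    have h2 : embedFree m β b * projV m β (psi 0) * embedFree m β a' =
        embedFree m β b * embedFree m β (twist hβ a') * projV m β (psi 0) := by
      rw [mul_assoc, hc, mul_assoc]
    rw [h1, h2, ← mul_assoc (embedFree m β a)]
    abel
  | add x x' hx hx' =>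
    obtain ⟨a, b, h⟩ := hx
    obtain ⟨a', b', h'⟩ := hx'
    refine ⟨a + a', b + b', ?_⟩
    rw [map_add, h, h', map_add, map_add, add_mul]
    abel

theorem mem_range_embedFree_of_fixed (hK : ringChar K ≠ 2) (hβ : ∀ i ∈ β, r 0 i ∈ β)
    (hn : 2 ≤ n) {v : VCyc m β} (hv : rhoTilde m β v = v) : ∃ a, embedFree m β a = v := by
  obtain ⟨x, rfl⟩ := projV_surjective m v
  obtain ⟨a, b, h⟩ := exists_decomposition (m := m) hβ hn x
  rw [h] at hv ⊢
  rw [map_add, map_mul, rhoTilde_embedFree hn, rhoTilde_embedFree hn, rhoTilde_psi_zero, mul_neg,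
    add_right_inj] at hv
  set z := embedFree m β b * projV m β (psi 0)
  -- Here `hv` reads `-z = z`: the odd component is negated by `ρ̃` and yet fixed.
  have h2 : (2 : K) • z = 0 := by
    rw [two_smul]
    nth_rewrite 1 [← hv]
    exact neg_add_cancel z
  have hz : z = 0 := (smul_eq_zero_iff_right (Ring.two_ne_zero hK)).mp h2
  exact ⟨a, by rw [hz, add_zero]⟩

end Main

end QuiverHeckeBD

/-! ### The isomorphism -/

theorem mainTheorem5 {K : Type*} [Field K] (hK : ringChar K ≠ 2)
    (q : Kˣ) (hq : q ^ 2 ≠ 1)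
    {l : ℕ} (lam : Fin l → Kˣ)
    (hlam : ∀ a b, a ≠ b → Disjoint (QuiverHeckeBD.I q (lam a)) (QuiverHeckeBD.I q (lam b)))
    (m : QuiverHeckeBD.Vertex q lam →₀ ℕ) (hm : ∀ i, m i⁻¹ = m i)
    {n : ℕ} [NeZero n] (hn : 2 ≤ n)
    (β : Finset (Fin n → QuiverHeckeBD.Vertex q lam))
    (hβ : ∃ i : Fin n → QuiverHeckeBD.Vertex q lam,
      (β : Set (Fin n → QuiverHeckeBD.Vertex q lam)) = QuiverHeckeBD.orbitB i) :
    Nonempty (QuiverHeckeBD.WCyc m β ≃ₐ[K]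
      QuiverHeckeBD.fixedPoints (QuiverHeckeBD.rhoTilde m β)) := by
  open QuiverHeckeBD in
  -- Stability under `r_0` is what lets the twist permute the idempotents `e(i)` with `i ∈ β`.
  have hst : ∀ i ∈ β, r 0 i ∈ β := by
    obtain ⟨i₀, h⟩ := hβ
    intro i hi
    rw [← Finset.mem_coe, h] at hi ⊢
    exact r_mem_orbitB 0 hi
  obtain ⟨σ, hσ, hσσ⟩ := exists_involution_WCyc hm hst hn
  obtain ⟨θ, hθ⟩ := exists_embedding (m := m) hst hn
  obtain ⟨f, hf⟩ := exists_hom_crossedProduct hst hn hσ hσσ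
  have hθ' : ∀ x, θ (projW m β x) = embedFree m β x := DFunLike.congr_fun hθ
  have hfθ : ∀ w, f (θ w) = twistedDiag σ w := fun w => by
    obtain ⟨x, rfl⟩ := projW_surjective m w
    rw [hθ']
    exact DFunLike.congr_fun hf x
  -- The matrix representation recovers `w` from `θ w` as the upper left entry.
  have hinj : Function.Injective θ := fun v w h =>
    twistedDiag_injective σ (by rw [← hfθ, ← hfθ, h])
  have hmem : ∀ w, θ w ∈ fixedPoints (rhoTilde m β) := fun w => by
    obtain ⟨x, rfl⟩ := projW_surjective m w
    change rhoTilde m β _ = _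
    rw [hθ', rhoTilde_embedFree hn]
    rfl
  refine ⟨AlgEquiv.ofBijective (θ.codRestrict _ hmem) ⟨fun v w h => hinj ?_, fun v => ?_⟩⟩
  · exact congrArg Subtype.val h
  · obtain ⟨a, ha⟩ := mem_range_embedFree_of_fixed hK hst hn v.2
    exact ⟨projW m β a, Subtype.ext ((hθ' a).trans ha)⟩
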